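/- Let $k\ge 0$ and $n$ be integers, let $A\in\mathbb{C}^{k\times k}$ be Hermitian positive semidefinite with $\operatorname{rk}(A)<n$, and let $$S_A^{(k,n)}=\{X\in\mathbb{C}^{k\times n} : XX^{\mathsf H}=A\}$$ be the generalized Stiefel manifold. Let $U(n)$ denote the unitary group, acting on $S_A^{(k,n)}$ by right multiplication $X\mapsto XV$. Tangent vectors of $S_A^{(k,n)}$ are regarded as matrices, $g(\Delta_1,\Delta_2)=\operatorname{Re}\operatorname{tr}(\Delta_1\Delta_2^{\mathsf H})$ is the Euclidean metric, and $\mathrm{Vol}$ is the Riemannian volume measure of $(S_A^{(k,n)},g)$. (a) $S_A^{(k,n)}$ is a nonempty smooth submanifold of $\mathbb{C}^{k\times n}$ of real dimension $\operatorname{rk}(A)\,(2n-\operatorname{rk}(A))$, $U(n)\subset\mathbb{C}^{n\times n}$ is a Lie group (a smooth submanifold of real dimension $n^2$), and the right action of $U(n)$ on $S_A^{(k,n)}$ is smooth and transitive; that is, $S_A^{(k,n)}$ is a $U(n)$-homogeneous space. The metric $g$ and the measure $\mathrm{Vol}$ are $U(n)$-invariant. Moreover $0<\mathrm{Vol}(S_A^{(k,n)})<\infty$,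 and the uniform distribution $P_{\mathrm H}=\mathrm{Vol}(\cdot)/\mathrm{Vol}(S_A^{(k,n)})$ is the unique $U(n)$-invariant Borel probability measure on $S_A^{(k,n)}$. (b) If the random matrix $F$ is distributed according to the uniform distribution on $S_A^{(k,n)}$, then for every $m$ and every $K\in\mathbb{C}^{m\times k}$ the random matrix $KF$ is distributed according to the uniform distribution on $S_{KAK^{\mathsf H}}^{(m,n)}$. -/

import Mathlib

open MeasureTheory ProbabilityTheory Set
open scoped Matrix Manifold ContDiff ENNReal ComplexOrder

noncomputable section

namespace GenStiefel

/-! ### Embedded smooth manifolds -/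

section Submanifold

variable {E : Type*} [NormedAddCommGroup E] [NormedSpace ℝ E]
variable {M : Type*} [TopologicalSpace M]

/-- `e` is a smooth chart, with values in `ℝ^d`, of the subset `ι(M)` of the normed space `E`:
the parametrization `ι ∘ e⁻¹` is smooth as a map into `E`, and the coordinate map `e` extends,
near each point of its domain, to a smooth map on an open subset of `E`. -/
structure IsSmoothChart (d : ℕ) (ι : M → E)
    (e : OpenPartialHomeomorph M (EuclideanSpace ℝ (Fin d))) : Prop where
  contDiffOn_param : ContDiffOn ℝ ∞ (fun x => ι (e.symm x)) e.target
  exists_extension : ∀ p ∈ e.source, ∃ (W : Set E) (ψ : E → EuclideanSpace ℝ (Fin d)),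
    IsOpen W ∧ ι p ∈ W ∧ ContDiffOn ℝ ∞ ψ W ∧ ∀ q ∈ e.source, ι q ∈ W → ψ (ι q) = e q

/-- `ι : M → E` realizes `M` as a smooth `d`-dimensional submanifold of `E`: it is a topological
embedding, and each point of `M` lies in the domain of a smooth chart. -/
structure IsSmoothSubmanifold (d : ℕ) (ι : M → E) : Prop where
  isEmbedding : Topology.IsEmbedding ι
  exists_chart : ∀ p : M, ∃ e : OpenPartialHomeomorph M (EuclideanSpace ℝ (Fin d)),
    IsSmoothChart d ι e ∧ p ∈ e.source

/-- The smooth structure of a submanifold: the atlas consists of all smooth charts. -/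
@[reducible] def IsSmoothSubmanifold.chartedSpace {d : ℕ} {ι : M → E}
    (h : IsSmoothSubmanifold d ι) : ChartedSpace (EuclideanSpace ℝ (Fin d)) M where
  atlas := {e | IsSmoothChart d ι e}
  chartAt p := (h.exists_chart p).choose
  mem_chart_source p := (h.exists_chart p).choose_spec.2
  chart_mem_atlas p := (h.exists_chart p).choose_spec.1

end Submanifold

/-- `M` is a smooth homogeneous space for the right action `act` of the Lie group `G`: `M` is a
nonempty smooth manifold, and `act` is a smooth and transitive right group action. -/
structure IsHomogeneousSpace {d e : ℕ}
    {M : Type*} [TopologicalSpace M] [ChartedSpace (EuclideanSpace ℝ (Fin d)) M]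
    {G : Type*} [Group G] [TopologicalSpace G] [ChartedSpace (EuclideanSpace ℝ (Fin e)) G]
    (act : M → G → M) : Prop where
  isManifold : IsManifold (𝓡 d) ∞ M
  lieGroup : LieGroup (𝓡 e) ∞ G
  nonempty : Nonempty M
  act_one : ∀ x, act x 1 = x
  act_mul : ∀ x g h, act x (g * h) = act (act x g) h
  smooth : ContMDiff ((𝓡 d).prod (𝓡 e)) (𝓡 d) ∞ (fun p : M × G => act p.1 p.2)
  transitive : ∀ x y, ∃ g, act x g = y

/-! ### The Euclidean metric and the Riemannian volume -/

/-- The real vector space `ℂ^{k × n}` of arrays. Its sup norm only serves to speak of derivatives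
and topology, which do not depend on the choice of a norm; lengths and volumes are measured by
`frobInner`. -/
abbrev Ambient (k n : ℕ) : Type := Fin k → Fin n → ℂ

/-- The real Euclidean inner product `Re tr(X Yᴴ)` on complex matrices. -/
def frobInner {k n : ℕ} (X Y : Ambient k n) : ℝ :=
  (Matrix.of X * (Matrix.of Y)ᴴ).trace.re

/-- The volume density `√det(g(∂ᵢφ, ∂ⱼφ))` of a parametrization `φ` with respect to the
Euclidean metric. -/
def volumeDensity {d k n : ℕ} (φ : EuclideanSpace ℝ (Fin d) → Ambient k n)
    (x : EuclideanSpace ℝ (Fin d)) : ℝ≥0∞ :=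
  ENNReal.ofReal (Real.sqrt (Matrix.det (Matrix.of fun i j : Fin d =>
    frobInner (fderiv ℝ φ x (EuclideanSpace.single i 1))
      (fderiv ℝ φ x (EuclideanSpace.single j 1)))))

/-- The Riemannian volume measure on the domain of the chart `e` (zero outside the domain): the
image under `e⁻¹` of the measure `√det(g) dx` on the range of `e`. -/
def chartVolume {d k n : ℕ} {M : Type*} [TopologicalSpace M] [MeasurableSpace M]
    (ι : M → Ambient k n)
    (e : OpenPartialHomeomorph M (EuclideanSpace ℝ (Fin d))) : Measure M :=
  Measure.map e.symm
    ((volume.restrict e.target).withDensity (volumeDensity fun x => ι (e.symm x)))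

/-- The Riemannian volume measure of the `d`-dimensional submanifold `ι : M → ℂ^{k × n}` with the
Euclidean metric. On the domain of a smooth chart it is given by that chart; as these measures
agree on overlaps, it is the least measure that dominates all of them. -/
def riemannianVolume (d : ℕ) {k n : ℕ} {M : Type*} [TopologicalSpace M] [MeasurableSpace M]
    (ι : M → Ambient k n) : Measure M :=
  ⨆ (e : OpenPartialHomeomorph M (EuclideanSpace ℝ (Fin d))) (_ : IsSmoothChart d ι e),
    chartVolume ι e

/-! ### Generalized Stiefel manifolds -/

/-- The unitary group `U(n)`. -/
abbrev U (n : ℕ) : Type := Matrix.unitaryGroup (Fin n) ℂ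

/-- The generalized Stiefel manifold `{X ∈ ℂ^{k × n} : X Xᴴ = A}`. -/
abbrev Stiefel {k : ℕ} (A : Matrix (Fin k) (Fin k) ℂ) (n : ℕ) : Type :=
  {X : Matrix (Fin k) (Fin n) ℂ // X * Xᴴ = A}

/-- The Borel σ-algebra on the generalized Stiefel manifold. -/
instance {k : ℕ} (A : Matrix (Fin k) (Fin k) ℂ) (n : ℕ) : MeasurableSpace (Stiefel A n) :=
  borel (Stiefel A n)

instance {k : ℕ} (A : Matrix (Fin k) (Fin k) ℂ) (n : ℕ) : BorelSpace (Stiefel A n) := ⟨rfl⟩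

/-- The real dimension `r (2 n - r)`, `r = rk A`, of the generalized Stiefel manifold. -/
abbrev stiefelDim {k : ℕ} (A : Matrix (Fin k) (Fin k) ℂ) (n : ℕ) : ℕ :=
  A.rank * (2 * n - A.rank)

/-- The inclusion of the unitary group into the space of matrices. -/
def unitaryIncl (n : ℕ) : U n → Ambient n n := fun V i j => V.1 i j

variable {k n : ℕ} {A : Matrix (Fin k) (Fin k) ℂ}

/-- The inclusion of the generalized Stiefel manifold into the space of matrices. -/
def incl (A : Matrix (Fin k) (Fin k) ℂ) (n : ℕ) :
    Stiefel A n → Ambient k n := fun X i j => X.1 i j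

/-- The right action `X ↦ X V` of the unitary group. -/
def rightMul (X : Stiefel A n) (V : U n) : Stiefel A n :=
  ⟨X.1 * V.1, by
    have h : V.1 * V.1ᴴ = 1 := Matrix.mem_unitaryGroup_iff.mp V.2
    rw [Matrix.conjTranspose_mul, Matrix.mul_assoc, ← Matrix.mul_assoc V.1, h, Matrix.one_mul,
      X.2]⟩

/-- The map `X ↦ K X`. -/
def leftMul {m : ℕ} (K : Matrix (Fin m) (Fin k) ℂ) (X : Stiefel A n) :
    Stiefel (K * A * Kᴴ) n :=
  ⟨K * X.1, by
    rw [Matrix.conjTranspose_mul, Matrix.mul_assoc, ← Matrix.mul_assoc X.1, X.2,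
      Matrix.mul_assoc]⟩

/-- The Euclidean metric `g(Δ₁, Δ₂) = Re tr(Δ₁ Δ₂ᴴ)` on the tangent space at `X`, where tangent
vectors are viewed as matrices through the differential of the inclusion. -/
def metric {d : ℕ} [ChartedSpace (EuclideanSpace ℝ (Fin d)) (Stiefel A n)] (X : Stiefel A n)
    (v w : TangentSpace (𝓡 d) X) : ℝ :=
  frobInner
    (mfderiv (𝓡 d) 𝓘(ℝ, Ambient k n) (incl A n) X v : Ambient k n)
    (mfderiv (𝓡 d) 𝓘(ℝ, Ambient k n) (incl A n) X w : Ambient k n)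

/-- The Euclidean volume measure on the generalized Stiefel manifold. -/
def Vol (A : Matrix (Fin k) (Fin k) ℂ) (n : ℕ) : Measure (Stiefel A n) :=
  riemannianVolume (stiefelDim A n) (incl A n)

/-- The uniform distribution: the normalized volume. -/
def uniform (A : Matrix (Fin k) (Fin k) ℂ) (n : ℕ) : Measure (Stiefel A n) :=
  (Vol A n univ)⁻¹ • Vol A n

/-- A measure on the generalized Stiefel manifold is `U(n)`-invariant. -/
def IsInvariant (μ : Measure (Stiefel A n)) : Prop :=
  ∀ V : U n, μ.map (fun X => rightMul X V) = μ

end GenStiefel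

end

/-! Write `A = L Lᴴ` with `L` of full column rank `r = rk A` and left inverse `P`. Then `X ↦ P X`
and `Y ↦ L Y` are mutually inverse bijections between the solutions of `X Xᴴ = A` and the matrices
with `r` orthonormal rows, and they commute with right multiplication by `U(n)`. Geometry and
transitivity thus reduce to orthonormal rows.

For charts, fix `Y₀` and set `E = (1 + Y Y₀ᴴ)⁻¹`, `Z = E (Y + Y₀)`, a rectangular Cayley transform.
The equation `Y Yᴴ = 1` becomes the pair of conditions `Z Y₀ᴴ = 1`, `E + Eᴴ = Z Zᴴ`, so `Z = Y₀ + B`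
with `B Y₀ᴴ = 0` and `E = ½ Z Zᴴ + S` with `S` skew-Hermitian. The pair `(S, B)` ranges freely over
a real vector space of dimension `r² + 2r(n - r) = r(2n - r)` (`cayley_forward`, `cayley_backward`,
`exists_isSmoothChart_of_range`). The case `A = 1` gives `U(n)`. Transitivity holds because
orthonormal rows complete to a unitary matrix.

The volume is a supremum of chart measures. They agree on overlaps by change of variables
(`chartVolume_eq_of_subset`), so compactness makes the total finite, and immersivity makes it
positive. Right multiplication by a unitary is a linear isometry of the ambient space, hence
preserves metric and volume (`metric_rightMul`, `map_riemannianVolume`).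

Uniqueness of the invariant probability comes from averaging over Haar measure
(`eq_of_invariant_of_transitive`). It yields (b) at once: `X ↦ K X` commutes with the action, so the
image of the uniform law is an invariant probability on the target. -/

namespace GenStiefel

/-! ### Smooth maps into and out of embedded submanifolds -/

section SmoothSubmanifold

variable {E : Type*} [NormedAddCommGroup E] [NormedSpace ℝ E]
variable {M : Type*} [TopologicalSpace M] {d : ℕ} {ι : M → E}

/-- A map into the domain of a smooth chart is smooth in coordinates as soon as it is smooth as a
map into the ambient space. -/
theorem IsSmoothChart.contDiffOn_comp {e : OpenPartialHomeomorph M (EuclideanSpace ℝ (Fin d))}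
    (he : IsSmoothChart d ι e) {F : Type*} [NormedAddCommGroup F] [NormedSpace ℝ F]
    {g : F → M} {s : Set F} (hg : ContDiffOn ℝ ∞ (fun x => ι (g x)) s)
    (hs : MapsTo g s e.source) : ContDiffOn ℝ ∞ (fun x => e (g x)) s := by
  intro x hx
  obtain ⟨W, ψ, hW, hxW, hψ, hψe⟩ := he.exists_extension (g x) (hs hx)
  have h1 : ContDiffWithinAt ℝ ∞ (fun y => ψ (ι (g y))) s x :=
    (hψ.contDiffAt (hW.mem_nhds hxW)).comp_contDiffWithinAt x (hg x hx)
  refine h1.congr_of_eventuallyEq ?_ (hψe _ (hs hx) hxW).symm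
  have h2 : ∀ᶠ y in nhdsWithin x s, ι (g y) ∈ W :=
    (hg x hx).continuousWithinAt (hW.mem_nhds hxW)
  filter_upwards [h2, self_mem_nhdsWithin] with y hy hys
  exact (hψe _ (hs hys) hy).symm

theorem IsSmoothChart.contDiffOn_transition
    {e f : OpenPartialHomeomorph M (EuclideanSpace ℝ (Fin d))}
    (he : IsSmoothChart d ι e) (hf : IsSmoothChart d ι f) :
    ContDiffOn ℝ ∞ (fun x => f (e.symm x)) (e.symm ≫ₕ f).source := by
  refine hf.contDiffOn_comp (he.contDiffOn_param.mono ?_) ?_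
  · intro x hx
    simpa using hx.1
  · intro x hx
    simpa using hx.2

variable (h : IsSmoothSubmanifold d ι)
include h

theorem IsSmoothSubmanifold.isManifold :
    letI := h.chartedSpace
    IsManifold (𝓡 d) ∞ M := by
  let _ := h.chartedSpace
  refine isManifold_of_contDiffOn _ _ _ fun e e' he he' => ?_
  have := IsSmoothChart.contDiffOn_transition (ι := ι) he he'
  simpa [Function.comp_def] using this

theorem IsSmoothSubmanifold.contMDiff_incl :
    letI := h.chartedSpace
    ContMDiff (𝓡 d) 𝓘(ℝ, E) ∞ ι := by
  let _ := h.chartedSpace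
  intro p
  rw [contMDiffAt_iff_source, contMDiffWithinAt_iff_contDiffWithinAt]
  have hc : IsSmoothChart d ι (chartAt (EuclideanSpace ℝ (Fin d)) p) :=
    chart_mem_atlas (EuclideanSpace ℝ (Fin d)) p
  have h1 := hc.contDiffOn_param.contDiffAt
    ((chartAt (EuclideanSpace ℝ (Fin d)) p).open_target.mem_nhds
      (mem_chart_target (EuclideanSpace ℝ (Fin d)) p))
  simpa [Function.comp_def, contDiffWithinAt_univ] using h1

/-- The embedding gives continuity of `g`, so nearby points stay in one chart domain; there the
coordinates of `g` are `ψ ∘ ι ∘ g` with `ψ` a smooth ambient extension. Every smoothness claim about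
the action is thereby checked on matrices. -/
theorem IsSmoothSubmanifold.contMDiff_of_comp {E' : Type*} [NormedAddCommGroup E']
    [NormedSpace ℝ E'] {H : Type*} [TopologicalSpace H] {I : ModelWithCorners ℝ E' H}
    {N : Type*} [TopologicalSpace N] [ChartedSpace H N] {g : N → M}
    (hg : ContMDiff I 𝓘(ℝ, E) ∞ (fun x => ι (g x))) :
    letI := h.chartedSpace
    ContMDiff I (𝓡 d) ∞ g := by
  let _ := h.chartedSpace
  have hgc : Continuous g := h.isEmbedding.continuous_iff.2 hg.continuous
  intro x
  rw [contMDiffAt_iff_target]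
  refine ⟨hgc.continuousAt, ?_⟩
  set e := chartAt (EuclideanSpace ℝ (Fin d)) (g x) with he
  have hc : IsSmoothChart d ι e := chart_mem_atlas (EuclideanSpace ℝ (Fin d)) (g x)
  have hx : g x ∈ e.source := mem_chart_source (EuclideanSpace ℝ (Fin d)) (g x)
  obtain ⟨W, ψ, hW, hxW, hψ, hψe⟩ := hc.exists_extension (g x) hx
  have h1 : ContMDiffAt I 𝓘(ℝ, EuclideanSpace ℝ (Fin d)) ∞ (fun y => ψ (ι (g y))) x :=
    (hψ.contDiffAt (hW.mem_nhds hxW)).contMDiffAt.comp x (hg x)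
  refine h1.congr_of_eventuallyEq ?_
  filter_upwards [hgc.continuousAt.preimage_mem_nhds (e.open_source.mem_nhds hx),
    hg.continuous.continuousAt.preimage_mem_nhds (hW.mem_nhds hxW)] with y hy1 hy2
  simpa [← he] using (hψe _ hy1 hy2).symm

end SmoothSubmanifold

/-- A pair of mutually inverse maps between `ℝ^d` and the part of `M` in an open set `W` is a
smooth chart. -/
theorem exists_isSmoothChart {E : Type*} [NormedAddCommGroup E] [NormedSpace ℝ E]
    {M : Type*} [TopologicalSpace M] {d : ℕ} {ι : M → E} (hι : Topology.IsEmbedding ι)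
    {W : Set E} (hW : IsOpen W) {ψ : E → EuclideanSpace ℝ (Fin d)} (hψ : ContDiffOn ℝ ∞ ψ W)
    {φ : EuclideanSpace ℝ (Fin d) → M} (hφ : ContDiff ℝ ∞ (fun x => ι (φ x)))
    (hφW : ∀ x, ι (φ x) ∈ W) (hψφ : ∀ x, ψ (ι (φ x)) = x)
    (hφψ : ∀ p, ι p ∈ W → φ (ψ (ι p)) = p) :
    ∃ e : OpenPartialHomeomorph M (EuclideanSpace ℝ (Fin d)),
      IsSmoothChart d ι e ∧ e.source = ι ⁻¹' W := by
  let e : OpenPartialHomeomorph M (EuclideanSpace ℝ (Fin d)) :=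
    { toFun := fun p => ψ (ι p)
      invFun := φ
      source := ι ⁻¹' W
      target := univ
      map_source' := fun _ _ => mem_univ _
      map_target' := fun x _ => hφW x
      left_inv' := fun p hp => hφψ p hp
      right_inv' := fun x _ => hψφ x
      open_source := hW.preimage hι.continuous
      open_target := isOpen_univ
      continuousOn_toFun := hψ.continuousOn.comp hι.continuous.continuousOn fun _ hp => hp
      continuousOn_invFun := (hι.continuous_iff.2 hφ.continuous).continuousOn }
  exact ⟨e, ⟨hφ.contDiffOn, fun p hp => ⟨W, ψ, hW, hp, hψ, fun _ _ _ => rfl⟩⟩, rfl⟩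

/-! ### Gram determinants and the volume density -/

section Density

variable {d k n : ℕ}

theorem frobInner_eq_sum (X Y : Ambient k n) :
    frobInner X Y = ∑ i, ∑ j, (X i j * (starRingEnd ℂ) (Y i j)).re := by
  simp [frobInner, Matrix.trace, Matrix.mul_apply]

theorem frobInner_self_nonneg (X : Ambient k n) : 0 ≤ frobInner X X := by
  rw [frobInner_eq_sum]
  refine Finset.sum_nonneg fun i _ => Finset.sum_nonneg fun j _ => ?_
  rw [Complex.mul_conj, Complex.ofReal_re]
  exact Complex.normSq_nonneg _

theorem eq_zero_of_frobInner_self {X : Ambient k n} (h : frobInner X X = 0) : X = 0 := by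
  rw [frobInner_eq_sum] at h
  have hnn : ∀ i j, 0 ≤ (X i j * (starRingEnd ℂ) (X i j)).re := fun i j => by
    rw [Complex.mul_conj, Complex.ofReal_re]
    exact Complex.normSq_nonneg _
  rw [Finset.sum_eq_zero_iff_of_nonneg fun i _ => Finset.sum_nonneg fun j _ => hnn i j] at h
  ext i j
  have h1 := h i (Finset.mem_univ i)
  rw [Finset.sum_eq_zero_iff_of_nonneg fun j _ => hnn i j] at h1
  have h2 := h1 j (Finset.mem_univ j)
  rw [Complex.mul_conj, Complex.ofReal_re] at h2
  exact Complex.normSq_eq_zero.1 h2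

/-- The Euclidean inner product as a bilinear form. -/
noncomputable def frobForm (k n : ℕ) : LinearMap.BilinForm ℝ (Ambient k n) :=
  LinearMap.mk₂ ℝ frobInner
    (fun X Y Z => by
      simp only [frobInner_eq_sum, ← Finset.sum_add_distrib, Pi.add_apply, add_mul, Complex.add_re])
    (fun c X Y => by
      simp only [frobInner_eq_sum, Finset.mul_sum, Pi.smul_apply, smul_eq_mul,
        Complex.real_smul, mul_assoc, Complex.re_ofReal_mul])
    (fun X Y Z => by
      simp only [frobInner_eq_sum, ← Finset.sum_add_distrib, Pi.add_apply, map_add, mul_add,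
        Complex.add_re])
    (fun c X Y => by
      simp only [frobInner_eq_sum, Finset.mul_sum, Pi.smul_apply, smul_eq_mul,
        Complex.real_smul, map_mul, Complex.conj_ofReal, mul_left_comm _ (c : ℂ),
        Complex.re_ofReal_mul])

/-- The Gram matrix of the columns of a linear map. -/
noncomputable def gramMatrix (J : EuclideanSpace ℝ (Fin d) →L[ℝ] Ambient k n) :
    Matrix (Fin d) (Fin d) ℝ :=
  Matrix.of fun i j => frobInner (J (EuclideanSpace.single i 1)) (J (EuclideanSpace.single j 1))

theorem gramMatrix_eq_toMatrix (J : EuclideanSpace ℝ (Fin d) →L[ℝ] Ambient k n) :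
    gramMatrix J = LinearMap.BilinForm.toMatrix (EuclideanSpace.basisFun (Fin d) ℝ).toBasis
      ((frobForm k n).comp (J : EuclideanSpace ℝ (Fin d) →ₗ[ℝ] Ambient k n) J) := by
  ext i j
  simp [gramMatrix, LinearMap.BilinForm.toMatrix_apply, frobForm]

theorem volumeDensity_eq (φ : EuclideanSpace ℝ (Fin d) → Ambient k n)
    (x : EuclideanSpace ℝ (Fin d)) :
    volumeDensity φ x = ENNReal.ofReal (Real.sqrt (gramMatrix (fderiv ℝ φ x)).det) := rfl

/-- Pulling the form back along `T` turns the Gram matrix `G` into `Tᵀ G T`. -/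
theorem det_gramMatrix_comp (J : EuclideanSpace ℝ (Fin d) →L[ℝ] Ambient k n)
    (T : EuclideanSpace ℝ (Fin d) →L[ℝ] EuclideanSpace ℝ (Fin d)) :
    (gramMatrix (J.comp T)).det = T.det ^ 2 * (gramMatrix J).det := by
  rw [gramMatrix_eq_toMatrix, gramMatrix_eq_toMatrix, ContinuousLinearMap.toLinearMap_comp,
    ← LinearMap.BilinForm.comp_comp, LinearMap.BilinForm.toMatrix_comp
      (EuclideanSpace.basisFun (Fin d) ℝ).toBasis (EuclideanSpace.basisFun (Fin d) ℝ).toBasis]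
  rw [Matrix.det_mul, Matrix.det_mul, Matrix.det_transpose, LinearMap.det_toMatrix]
  simp only [ContinuousLinearMap.det]
  ring

theorem det_gramMatrix_pos {J : EuclideanSpace ℝ (Fin d) →L[ℝ] Ambient k n}
    (hJ : Function.Injective J) : 0 < (gramMatrix J).det := by
  refine Matrix.PosDef.det_pos (Matrix.PosDef.of_dotProduct_mulVec_pos ?_ ?_)
  · ext i j
    simp only [gramMatrix, Matrix.conjTranspose_apply, Matrix.of_apply, star_trivial,
      frobInner_eq_sum]
    refine Finset.sum_congr rfl fun a _ => Finset.sum_congr rfl fun b _ => ?_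
    simp only [Complex.mul_re, Complex.conj_re, Complex.conj_im]
    ring
  · intro x hx
    have h1 : star x ⬝ᵥ gramMatrix J *ᵥ x
        = frobInner (J (WithLp.toLp 2 x)) (J (WithLp.toLp 2 x)) := by
      rw [gramMatrix_eq_toMatrix]
      exact (LinearMap.BilinForm.apply_eq_dotProduct_toMatrix_mulVec
        (EuclideanSpace.basisFun (Fin d) ℝ).toBasis
        ((frobForm k n).comp (J : EuclideanSpace ℝ (Fin d) →ₗ[ℝ] Ambient k n) J)
        (WithLp.toLp 2 x) (WithLp.toLp 2 x)).symm
    rw [h1]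
    refine lt_of_le_of_ne (frobInner_self_nonneg _) fun h0 => hx ?_
    have h2 : J (WithLp.toLp 2 x) = J 0 := by
      rw [map_zero]; exact eq_zero_of_frobInner_self h0.symm
    simpa using hJ h2

/-- The square root of the squared determinant is the Jacobian factor of the change of variables
formula; this makes the volume independent of the chart. -/
theorem volumeDensity_comp {φ : EuclideanSpace ℝ (Fin d) → Ambient k n}
    {τ : EuclideanSpace ℝ (Fin d) → EuclideanSpace ℝ (Fin d)} {x : EuclideanSpace ℝ (Fin d)}
    (hφ : DifferentiableAt ℝ φ (τ x)) (hτ : DifferentiableAt ℝ τ x) :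
    volumeDensity (fun y => φ (τ y)) x
      = ENNReal.ofReal |(fderiv ℝ τ x).det| * volumeDensity φ (τ x) := by
  rw [volumeDensity_eq, volumeDensity_eq, ← ENNReal.ofReal_mul (abs_nonneg _)]
  have : fderiv ℝ (fun y => φ (τ y)) x = (fderiv ℝ φ (τ x)).comp (fderiv ℝ τ x) :=
    fderiv_comp x hφ hτ
  rw [this, det_gramMatrix_comp, Real.sqrt_mul (sq_nonneg _), Real.sqrt_sq_eq_abs]

theorem volumeDensity_congr {φ φ' : EuclideanSpace ℝ (Fin d) → Ambient k n}
    {x : EuclideanSpace ℝ (Fin d)} (h : φ =ᶠ[nhds x] φ') :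
    volumeDensity φ x = volumeDensity φ' x := by
  rw [volumeDensity_eq, volumeDensity_eq, h.fderiv_eq]

theorem volumeDensity_isometry (T : Ambient k n ≃L[ℝ] Ambient k n)
    (hT : ∀ X Y, frobInner (T X) (T Y) = frobInner X Y)
    (φ : EuclideanSpace ℝ (Fin d) → Ambient k n) (x : EuclideanSpace ℝ (Fin d)) :
    volumeDensity (fun y => T (φ y)) x = volumeDensity φ x := by
  have : fderiv ℝ (fun y => T (φ y)) x = (T : Ambient k n →L[ℝ] Ambient k n).comp (fderiv ℝ φ x) :=
    T.comp_fderiv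
  simp only [volumeDensity_eq, this, gramMatrix, ContinuousLinearMap.comp_apply,
    ContinuousLinearEquiv.coe_coe, hT]

theorem continuous_det_gramMatrix :
    Continuous fun J : EuclideanSpace ℝ (Fin d) →L[ℝ] Ambient k n => (gramMatrix J).det := by
  have h (i : Fin d) : Continuous fun J : EuclideanSpace ℝ (Fin d) →L[ℝ] Ambient k n =>
      J (EuclideanSpace.single i 1) := by fun_prop
  refine Continuous.matrix_det (continuous_matrix fun i j => ?_)
  change Continuous fun J : EuclideanSpace ℝ (Fin d) →L[ℝ] Ambient k n =>
    frobInner (J (EuclideanSpace.single i 1)) (J (EuclideanSpace.single j 1))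
  simp only [frobInner_eq_sum]
  fun_prop

theorem measurable_volumeDensity (φ : EuclideanSpace ℝ (Fin d) → Ambient k n) :
    Measurable (volumeDensity φ) :=
  ENNReal.measurable_ofReal.comp (Real.continuous_sqrt.measurable.comp
    (continuous_det_gramMatrix.measurable.comp (measurable_fderiv ℝ φ)))

theorem continuousOn_volumeDensity {φ : EuclideanSpace ℝ (Fin d) → Ambient k n}
    {s : Set (EuclideanSpace ℝ (Fin d))} (hs : IsOpen s) (hφ : ContDiffOn ℝ ∞ φ s) :
    ContinuousOn (volumeDensity φ) s := by
  have h1 : ContinuousOn (fun x => gramMatrix (fderiv ℝ φ x) |>.det) s :=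
    continuous_det_gramMatrix.comp_continuousOn
      (hφ.continuousOn_fderiv_of_isOpen hs (by simp))
  exact ENNReal.continuous_ofReal.comp_continuousOn (Real.continuous_sqrt.comp_continuousOn h1)

end Density

/-! ### Nondegeneracy and transport of smooth charts -/

section Chart

variable {d k n : ℕ} {M : Type*} [TopologicalSpace M] {ι : M → Ambient k n}

/-- The smooth extension `ψ` of the coordinates is a left inverse of the parametrization near `x`.
By the chain rule the derivative of the parametrization is injective, so its Gram matrix is positive
definite. -/
theorem IsSmoothChart.volumeDensity_pos {e : OpenPartialHomeomorph M (EuclideanSpace ℝ (Fin d))}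
    (he : IsSmoothChart d ι e) {x : EuclideanSpace ℝ (Fin d)} (hx : x ∈ e.target) :
    0 < volumeDensity (fun y => ι (e.symm y)) x := by
  rw [volumeDensity_eq, ENNReal.ofReal_pos, Real.sqrt_pos]
  refine det_gramMatrix_pos ?_
  obtain ⟨W, ψ, hW, hxW, hψ, hψe⟩ := he.exists_extension (e.symm x) (e.map_target hx)
  have hφ : DifferentiableAt ℝ (fun y => ι (e.symm y)) x :=
    (he.contDiffOn_param.contDiffAt (e.open_target.mem_nhds hx)).differentiableAt (by simp)
  have hψd : DifferentiableAt ℝ ψ (ι (e.symm x)) :=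
    (hψ.contDiffAt (hW.mem_nhds hxW)).differentiableAt (by simp)
  have hcomp : fderiv ℝ (fun y => ψ (ι (e.symm y))) x
      = (fderiv ℝ ψ (ι (e.symm x))).comp (fderiv ℝ (fun y => ι (e.symm y)) x) :=
    fderiv_comp x hψd hφ
  have hid : (fun y => ψ (ι (e.symm y))) =ᶠ[nhds x] id := by
    filter_upwards [e.open_target.mem_nhds hx,
      hφ.continuousAt.preimage_mem_nhds (hW.mem_nhds hxW)] with y hy hyW
    rw [hψe _ (e.map_target hy) hyW, e.right_inv hy, id]
  rw [hid.fderiv_eq, fderiv_id] at hcomp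
  intro u v huv
  have := congrArg (fderiv ℝ ψ (ι (e.symm x))) huv
  rwa [← ContinuousLinearMap.comp_apply, ← ContinuousLinearMap.comp_apply, ← hcomp] at this

theorem IsSmoothChart.comp_isometry {e : OpenPartialHomeomorph M (EuclideanSpace ℝ (Fin d))}
    (he : IsSmoothChart d ι e) (g : M ≃ₜ M) (T : Ambient k n ≃L[ℝ] Ambient k n)
    (hg : ∀ p, ι (g p) = T (ι p)) :
    IsSmoothChart d ι (g.symm.toOpenPartialHomeomorph ≫ₕ e) := by
  have hg' : ∀ p, ι (g.symm p) = T.symm (ι p) := fun p => by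
    rw [T.eq_symm_apply, ← hg, g.apply_symm_apply]
  constructor
  · have : ContDiffOn ℝ ∞ (fun x => T (ι (e.symm x))) e.target :=
      T.contDiff.comp_contDiffOn he.contDiffOn_param
    simpa [hg] using this
  · intro p hp
    obtain ⟨W, ψ, hW, hpW, hψ, hψe⟩ := he.exists_extension (g.symm p) (by simpa using hp)
    refine ⟨T.symm ⁻¹' W, fun X => ψ (T.symm X), hW.preimage T.symm.continuous, ?_, ?_, ?_⟩
    · rwa [mem_preimage, ← hg']
    · exact hψ.comp T.symm.contDiff.contDiffOn fun _ hX => hX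
    · intro q hq hqW
      rw [mem_preimage, ← hg'] at hqW
      change ψ (T.symm (ι q)) = _
      rw [← hg', hψe _ (by simpa using hq) hqW]
      rfl

end Chart

/-! ### The Riemannian volume: independence of charts, finiteness, isometries -/

section Volume

variable {d k n : ℕ} {M : Type*} [TopologicalSpace M] [MeasurableSpace M] [BorelSpace M]
  {ι : M → Ambient k n}

theorem measurableSet_target_inter_preimage
    (e : OpenPartialHomeomorph M (EuclideanSpace ℝ (Fin d))) {s : Set M} (hs : MeasurableSet s) :
    MeasurableSet (e.target ∩ e.symm ⁻¹' s) := by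
  have h1 : Measurable (e.target.domRestrict e.symm) :=
    (continuousOn_iff_continuous_domRestrict.1 e.continuousOn_symm).measurable
  have h2 := e.open_target.measurableSet.subtype_image (h1 hs)
  convert h2 using 1
  ext x
  simp [Set.domRestrict, and_comm]

/-- Nothing is known about `e.symm` off the target, but the measure is carried by the target.
Without a.e. measurability, `Measure.map` would be zero by convention. -/
theorem aemeasurable_symm (e : OpenPartialHomeomorph M (EuclideanSpace ℝ (Fin d)))
    (ρ : EuclideanSpace ℝ (Fin d) → ℝ≥0∞) :
    AEMeasurable e.symm ((volume.restrict e.target).withDensity ρ) :=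
  (e.continuousOn_symm.aemeasurable e.open_target.measurableSet).mono_ac
    (withDensity_absolutelyContinuous _ _)

theorem chartVolume_apply (e : OpenPartialHomeomorph M (EuclideanSpace ℝ (Fin d)))
    {s : Set M} (hs : MeasurableSet s) :
    chartVolume ι e s
      = ∫⁻ x in e.target ∩ e.symm ⁻¹' s, volumeDensity (fun x => ι (e.symm x)) x := by
  rw [chartVolume, Measure.map_apply_of_aemeasurable (aemeasurable_symm e _) hs,
    withDensity_apply', Measure.restrict_restrict' e.open_target.measurableSet, inter_comm]

theorem chartVolume_inter_source (e : OpenPartialHomeomorph M (EuclideanSpace ℝ (Fin d)))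
    {s : Set M} (hs : MeasurableSet s) :
    chartVolume ι e (s ∩ e.source) = chartVolume ι e s := by
  rw [chartVolume_apply e hs, chartVolume_apply e (hs.inter e.open_source.measurableSet)]
  congr 2
  ext x
  simp only [mem_inter_iff, mem_preimage]
  exact ⟨fun h => ⟨h.1, h.2.1⟩, fun h => ⟨h.1, h.2, e.map_target h.1⟩⟩

/-- Smooth charts assign the same volume to the sets in their common domain. -/
theorem chartVolume_eq_of_subset {e f : OpenPartialHomeomorph M (EuclideanSpace ℝ (Fin d))}
    (he : IsSmoothChart d ι e) (hf : IsSmoothChart d ι f) {s : Set M} (hs : MeasurableSet s)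
    (hse : s ⊆ e.source) (hsf : s ⊆ f.source) :
    chartVolume ι e s = chartVolume ι f s := by
  rw [chartVolume_apply e hs, chartVolume_apply f hs]
  have hS := measurableSet_target_inter_preimage e hs
  set S := e.target ∩ e.symm ⁻¹' s with hSdef
  have hSsub : S ⊆ (e.symm ≫ₕ f).source := fun x hx => by
    simpa using ⟨hx.1, hsf hx.2⟩
  have himage : f.target ∩ f.symm ⁻¹' s = (fun x => f (e.symm x)) '' S := by
    ext y
    constructor
    · rintro ⟨hy, hys⟩
      refine ⟨e (f.symm y), ⟨e.map_source (hse hys), ?_⟩, ?_⟩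
      · simpa [e.left_inv (hse hys)] using hys
      · simp [e.left_inv (hse hys), f.right_inv hy]
    · rintro ⟨x, ⟨hx, hxs⟩, rfl⟩
      refine ⟨f.map_source (hsf hxs), ?_⟩
      simpa [f.left_inv (hsf hxs)] using hxs
  have hdiff : ∀ x ∈ S, DifferentiableAt ℝ (fun x => f (e.symm x)) x := fun x hx =>
    ((he.contDiffOn_transition hf).contDiffAt
      ((e.symm ≫ₕ f).open_source.mem_nhds (hSsub hx))).differentiableAt (by simp)
  have hinj : InjOn (fun x => f (e.symm x)) S := by
    intro x hx y hy hxy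
    exact e.symm.injOn hx.1 hy.1 (f.injOn (hsf hx.2) (hsf hy.2) hxy)
  -- Substitute along the transition map `f ∘ e⁻¹`; its Jacobian times the density of `f` is the
  -- density of `e`.
  rw [himage, lintegral_image_eq_lintegral_abs_det_fderiv_mul volume hS
    (fun x hx => (hdiff x hx).hasFDerivAt.hasFDerivWithinAt) hinj]
  refine setLIntegral_congr_fun hS fun x hx => ?_
  have hφ : DifferentiableAt ℝ (fun y => ι (f.symm y)) (f (e.symm x)) :=
    (hf.contDiffOn_param.contDiffAt
      (f.open_target.mem_nhds (f.map_source (hsf hx.2)))).differentiableAt (by simp)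
  rw [← volumeDensity_comp (τ := fun x => f (e.symm x)) hφ (hdiff x hx)]
  refine volumeDensity_congr ?_
  filter_upwards [(e.symm ≫ₕ f).open_source.mem_nhds (hSsub hx)] with y hy
  have hy' : e.symm y ∈ f.source := by simpa using hy.2
  simp [f.left_inv hy']

theorem IsSmoothSubmanifold.riemannianVolume_univ_pos [Nonempty M]
    (h : IsSmoothSubmanifold d ι) : 0 < riemannianVolume d ι univ := by
  obtain ⟨p⟩ := ‹Nonempty M›
  obtain ⟨e, he, hp⟩ := h.exists_chart p
  have h1 : chartVolume ι e ≤ riemannianVolume d ι := le_iSup₂_of_le e he le_rfl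
  refine lt_of_lt_of_le ?_ (h1 univ)
  rw [chartVolume_apply e MeasurableSet.univ, preimage_univ, inter_univ,
    lintegral_pos_iff_support (measurable_volumeDensity _),
    Measure.restrict_apply (measurableSet_support (measurable_volumeDensity _))]
  have h2 : Function.support (volumeDensity fun x => ι (e.symm x)) ∩ e.target = e.target :=
    inter_eq_right.2 fun x hx => (he.volumeDensity_pos hx).ne'
  rw [h2]
  exact e.open_target.measure_pos _ ⟨e p, e.map_source hp⟩

theorem IsSmoothChart.exists_isOpen_chartVolume_lt_top
    {e : OpenPartialHomeomorph M (EuclideanSpace ℝ (Fin d))}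
    (he : IsSmoothChart d ι e) {p : M} (hp : p ∈ e.source) :
    ∃ u : Set M, IsOpen u ∧ p ∈ u ∧ u ⊆ e.source ∧ chartVolume ι e u < ⊤ := by
  set ρ := volumeDensity fun x => ι (e.symm x) with hρ
  have hcont : ContinuousOn ρ e.target :=
    continuousOn_volumeDensity e.open_target he.contDiffOn_param
  have hlt : ρ (e p) < ρ (e p) + 1 :=
    ENNReal.lt_add_right (by rw [hρ, volumeDensity_eq]; exact ENNReal.ofReal_ne_top) one_ne_zero
  set c := ρ (e p) + 1 with hc
  have hctop : c ≠ ⊤ := ENNReal.add_ne_top.2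
    ⟨by rw [hρ, volumeDensity_eq]; exact ENNReal.ofReal_ne_top, ENNReal.one_ne_top⟩
  -- On `O` the density is below the finite constant `c`, and the unit ball keeps the Lebesgue
  -- measure finite.
  have hO : IsOpen ((e.target ∩ ρ ⁻¹' Iio c) ∩ Metric.ball (e p) 1) :=
    (hcont.isOpen_inter_preimage e.open_target isOpen_Iio).inter Metric.isOpen_ball
  set O := (e.target ∩ ρ ⁻¹' Iio c) ∩ Metric.ball (e p) 1 with hOdef
  have hu : IsOpen (e.source ∩ e ⁻¹' O) := e.isOpen_inter_preimage hO
  refine ⟨e.source ∩ e ⁻¹' O, hu, ⟨hp, ⟨e.map_source hp, hlt⟩, Metric.mem_ball_self one_pos⟩,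
    inter_subset_left, ?_⟩
  rw [chartVolume_apply e hu.measurableSet]
  have hsub : e.target ∩ e.symm ⁻¹' (e.source ∩ e ⁻¹' O) ⊆ O := fun x hx => by
    have := hx.2.2
    rwa [mem_preimage, e.right_inv hx.1] at this
  calc ∫⁻ x in e.target ∩ e.symm ⁻¹' (e.source ∩ e ⁻¹' O), ρ x
      ≤ ∫⁻ x in O, ρ x := lintegral_mono_set hsub
    _ ≤ ∫⁻ x in O, c := setLIntegral_mono measurable_const fun x hx => (mem_Iio.1 hx.1.2).le
    _ = c * volume O := setLIntegral_const _ _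
    _ ≤ c * volume (Metric.ball (e p) 1) := by gcongr; exact inter_subset_right
    _ < ⊤ := ENNReal.mul_lt_top hctop.lt_top measure_ball_lt_top

theorem IsSmoothSubmanifold.riemannianVolume_univ_lt_top [CompactSpace M]
    (h : IsSmoothSubmanifold d ι) : riemannianVolume d ι univ < ⊤ := by
  choose e he hp using h.exists_chart
  choose u hu hpu hue huv using fun p => (he p).exists_isOpen_chartVolume_lt_top (hp p)
  obtain ⟨t, ht⟩ := isCompact_univ.elim_finite_subcover u hu
    fun p _ => mem_iUnion.2 ⟨p, hpu p⟩
  -- This finite measure bounds the volume of every chart `f` at once, since on `u p` the charts `f`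
  -- and `e p` agree wherever both are defined; hence it bounds the supremum.
  set ν : Measure M := ∑ p ∈ t, (chartVolume ι (e p)).restrict (u p) with hν
  have hle : riemannianVolume d ι ≤ ν := by
    refine iSup₂_le fun f hf => Measure.le_iff.2 fun s hs => ?_
    have h1 : s ⊆ ⋃ p ∈ t, s ∩ u p := fun x hx => by
      obtain ⟨p, hpt, hxp⟩ := mem_iUnion₂.1 (ht (mem_univ x))
      exact mem_iUnion₂.2 ⟨p, hpt, hx, hxp⟩
    calc chartVolume ι f s ≤ chartVolume ι f (⋃ p ∈ t, s ∩ u p) := measure_mono h1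
      _ ≤ ∑ p ∈ t, chartVolume ι f (s ∩ u p) := measure_biUnion_finset_le _ _
      _ ≤ ∑ p ∈ t, (chartVolume ι (e p)).restrict (u p) s := by
          refine Finset.sum_le_sum fun p _ => ?_
          have hm : MeasurableSet (s ∩ u p) := hs.inter (hu p).measurableSet
          rw [Measure.restrict_apply hs, ← chartVolume_inter_source f hm,
            chartVolume_eq_of_subset hf (he p) (hm.inter f.open_source.measurableSet)
              inter_subset_right fun x hx => hue p hx.1.2]
          exact measure_mono inter_subset_left
      _ = ν s := by rw [hν, Measure.finsetSum_apply]
  refine (hle univ).trans_lt ?_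
  rw [hν, Measure.finsetSum_apply]
  refine ENNReal.sum_lt_top.2 fun p _ => ?_
  rw [Measure.restrict_apply_univ]
  exact huv p

/-- The transported chart has parametrization `T ∘ ι ∘ e.symm`, whose density is unchanged because
`T` is an isometry. -/
theorem map_chartVolume (e : OpenPartialHomeomorph M (EuclideanSpace ℝ (Fin d)))
    (g : M ≃ₜ M) (T : Ambient k n ≃L[ℝ] Ambient k n)
    (hT : ∀ X Y, frobInner (T X) (T Y) = frobInner X Y) (hg : ∀ p, ι (g p) = T (ι p)) :
    (chartVolume ι e).map g = chartVolume ι (g.symm.toOpenPartialHomeomorph ≫ₕ e) := by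
  have h1 : (volumeDensity fun x => ι ((g.symm.toOpenPartialHomeomorph ≫ₕ e).symm x))
      = volumeDensity fun x => ι (e.symm x) := by
    ext x
    rw [← volumeDensity_isometry T hT fun x => ι (e.symm x)]
    simp [hg]
  have h2 : (g.symm.toOpenPartialHomeomorph ≫ₕ e).target = e.target := by simp
  rw [chartVolume, chartVolume, h1, h2, AEMeasurable.map_map_of_aemeasurable
    g.continuous.measurable.aemeasurable (aemeasurable_symm e _)]
  rfl

theorem map_riemannianVolume_le (g : M ≃ₜ M) (T : Ambient k n ≃L[ℝ] Ambient k n)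
    (hT : ∀ X Y, frobInner (T X) (T Y) = frobInner X Y) (hg : ∀ p, ι (g p) = T (ι p)) :
    (riemannianVolume d ι).map g ≤ riemannianVolume d ι := by
  -- The universal property of the supremum bounds the volume only from above. So the inequality is
  -- first proved in the form pushed forward by `g.symm`, chart by chart, and then pushed forward by
  -- `g`.
  have h1 : riemannianVolume d ι ≤ (riemannianVolume d ι).map g.symm := by
    refine iSup₂_le fun e he => ?_
    have h2 : (chartVolume ι e).map g ≤ riemannianVolume d ι := by
      rw [map_chartVolume e g T hT hg]
      exact le_iSup₂_of_le (f := fun e (_ : IsSmoothChart d ι e) => chartVolume ι e) _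
        (he.comp_isometry g T hg) le_rfl
    have h3 := Measure.map_mono h2 g.symm.continuous.measurable
    rwa [Measure.map_map g.symm.continuous.measurable g.continuous.measurable,
      g.symm_comp_self, Measure.map_id] at h3
  have h4 := Measure.map_mono h1 g.continuous.measurable
  rwa [Measure.map_map g.continuous.measurable g.symm.continuous.measurable,
    g.self_comp_symm, Measure.map_id] at h4

/-- The Riemannian volume is invariant under restrictions of linear isometries. -/
theorem map_riemannianVolume (g : M ≃ₜ M) (T : Ambient k n ≃L[ℝ] Ambient k n)
    (hT : ∀ X Y, frobInner (T X) (T Y) = frobInner X Y) (hg : ∀ p, ι (g p) = T (ι p)) :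
    (riemannianVolume d ι).map g = riemannianVolume d ι := by
  refine le_antisymm (map_riemannianVolume_le g T hT hg) ?_
  have h1 := map_riemannianVolume_le (d := d) (ι := ι) g.symm T.symm
    (fun X Y => by rw [← hT, T.apply_symm_apply, T.apply_symm_apply])
    (fun p => by rw [T.eq_symm_apply, ← hg, g.apply_symm_apply])
  have h2 := Measure.map_mono h1 g.continuous.measurable
  rwa [Measure.map_map g.continuous.measurable g.symm.continuous.measurable,
    g.self_comp_symm, Measure.map_id] at h2

end Volume

/-! ### Smooth matrix-valued functions -/

section MatrixSmooth

variable {E : Type*} [NormedAddCommGroup E] [NormedSpace ℝ E] {l m p : Type*} {s : Set E}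

/-- All entries of a matrix-valued function are smooth. -/
def MatrixContDiffOn (f : E → Matrix l m ℂ) (s : Set E) : Prop :=
  ∀ i j, ContDiffOn ℝ ∞ (fun x => f x i j) s

namespace MatrixContDiffOn

theorem const (A : Matrix l m ℂ) : MatrixContDiffOn (fun _ : E => A) s :=
  fun _ _ => contDiffOn_const

theorem add {f g : E → Matrix l m ℂ} (hf : MatrixContDiffOn f s) (hg : MatrixContDiffOn g s) :
    MatrixContDiffOn (fun x => f x + g x) s := fun i j => (hf i j).add (hg i j)

theorem sub {f g : E → Matrix l m ℂ} (hf : MatrixContDiffOn f s) (hg : MatrixContDiffOn g s) :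
    MatrixContDiffOn (fun x => f x - g x) s := fun i j => (hf i j).sub (hg i j)

theorem const_smul {f : E → Matrix l m ℂ} (c : ℂ) (hf : MatrixContDiffOn f s) :
    MatrixContDiffOn (fun x => c • f x) s := fun i j => contDiffOn_const.mul (hf i j)

theorem mul [Fintype m] {f : E → Matrix l m ℂ} {g : E → Matrix m p ℂ}
    (hf : MatrixContDiffOn f s) (hg : MatrixContDiffOn g s) :
    MatrixContDiffOn (fun x => f x * g x) s := fun i j => by
  simp only [Matrix.mul_apply]
  exact ContDiffOn.sum fun a _ => (hf i a).mul (hg a j)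

theorem conjTranspose {f : E → Matrix l m ℂ} (hf : MatrixContDiffOn f s) :
    MatrixContDiffOn (fun x => (f x)ᴴ) s := fun i j =>
  Complex.conjCLE.contDiff.comp_contDiffOn (hf j i)

variable [Fintype l] [DecidableEq l]

theorem det {f : E → Matrix l l ℂ} (hf : MatrixContDiffOn f s) :
    ContDiffOn ℝ ∞ (fun x => (f x).det) s := by
  simp only [Matrix.det_apply']
  exact ContDiffOn.sum fun σ _ => contDiffOn_const.mul (contDiffOn_prod fun i _ => hf _ _)

theorem inv {f : E → Matrix l l ℂ} (hf : MatrixContDiffOn f s) (h : ∀ x ∈ s, (f x).det ≠ 0) :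
    MatrixContDiffOn (fun x => (f x)⁻¹) s := fun i j => by
  simp only [Matrix.inv_def, Matrix.smul_apply, Matrix.adjugate_apply, smul_eq_mul,
    Ring.inverse_eq_inv']
  refine (hf.det.inv h).mul (det fun a b => ?_)
  by_cases ha : a = j
  · subst ha
    simpa using contDiffOn_const
  · simpa [Matrix.updateRow_ne ha] using hf a b

end MatrixContDiffOn

end MatrixSmooth

/-! ### The Cayley transform of matrices with orthonormal rows -/

section Cayley

variable {r n : Type*} [Fintype r] [DecidableEq r] [Fintype n]
  {Y Y₀ Z : Matrix r n ℂ} {E : Matrix r r ℂ}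

/-- With `D = 1 + Y Y₀ᴴ`, orthonormality gives `(Y + Y₀) Y₀ᴴ = D` and `(Y + Y₀)(Y + Y₀)ᴴ = D + Dᴴ`.
Multiplying by `E = D⁻¹` on the left, and in the second case also by `Eᴴ` on the right, gives the
first two identities. -/
theorem cayley_forward (hY : Y * Yᴴ = 1) (hY₀ : Y₀ * Y₀ᴴ = 1) (hD : (1 + Y * Y₀ᴴ).det ≠ 0)
    (hE : E = (1 + Y * Y₀ᴴ)⁻¹) (hZ : Z = E * (Y + Y₀)) :
    Z * Y₀ᴴ = 1 ∧ E + Eᴴ = Z * Zᴴ ∧ E⁻¹ * Z - Y₀ = Y := by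
  have hu : IsUnit (1 + Y * Y₀ᴴ).det := isUnit_iff_ne_zero.2 hD
  have hED : E * (1 + Y * Y₀ᴴ) = 1 := hE ▸ Matrix.nonsing_inv_mul _ hu
  have hDE : (1 + Y₀ * Yᴴ) * Eᴴ = 1 := by
    have := congrArg Matrix.conjTranspose hED
    simpa [Matrix.conjTranspose_mul, Matrix.conjTranspose_add] using this
  refine ⟨?_, ?_, ?_⟩
  · rw [hZ, Matrix.mul_assoc, Matrix.add_mul, hY₀, add_comm, hED]
  · have h1 : (Y + Y₀) * (Y + Y₀)ᴴ = (1 + Y * Y₀ᴴ) + (1 + Y₀ * Yᴴ) := by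
      rw [Matrix.conjTranspose_add, Matrix.add_mul, Matrix.mul_add, Matrix.mul_add, hY, hY₀]
      abel
    calc E + Eᴴ = E * ((1 + Y₀ * Yᴴ) * Eᴴ) + E * (1 + Y * Y₀ᴴ) * Eᴴ := by
          rw [hDE, hED, Matrix.mul_one, Matrix.one_mul]
      _ = E * ((Y + Y₀) * (Y + Y₀)ᴴ) * Eᴴ := by
          rw [h1]
          generalize 1 + Y * Y₀ᴴ = D
          generalize 1 + Y₀ * Yᴴ = D'
          rw [Matrix.mul_add, Matrix.add_mul, Matrix.mul_assoc E D', add_comm]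
      _ = Z * Zᴴ := by
          rw [hZ, Matrix.conjTranspose_mul]
          simp only [Matrix.mul_assoc]
  · have hEu : IsUnit E.det := hE ▸ (Matrix.isUnit_nonsing_inv_det _ hu)
    rw [hZ, ← Matrix.mul_assoc, Matrix.nonsing_inv_mul _ hEu, Matrix.one_mul, add_sub_cancel_right]

/-- If `E v = 0`, then `‖Zᴴ v‖² = vᴴ (E + Eᴴ) v = 0`, so `v = Y₀ Zᴴ v = 0`. Thus the inverse
transform is defined on the whole coordinate space. -/
theorem det_ne_zero_of_add_conjTranspose (hZ : Z * Y₀ᴴ = 1) (hE : E + Eᴴ = Z * Zᴴ) :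
    E.det ≠ 0 := by
  intro h0
  obtain ⟨v, hv, hEv⟩ := Matrix.exists_mulVec_eq_zero_iff.2 h0
  have h1 : star v ⬝ᵥ (E + Eᴴ) *ᵥ v = 0 := by
    rw [Matrix.add_mulVec, hEv, zero_add, Matrix.dotProduct_mulVec, ← Matrix.star_mulVec, hEv,
      star_zero, zero_dotProduct]
  rw [hE, ← Matrix.mulVec_mulVec, Matrix.dotProduct_mulVec] at h1
  have h2 : star v ᵥ* Z = star (Zᴴ *ᵥ v) := by
    rw [Matrix.star_mulVec, Matrix.conjTranspose_conjTranspose]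
  rw [h2, dotProduct_comm, dotProduct_self_star_eq_zero] at h1
  have h3 : Y₀ * Zᴴ = 1 := by
    simpa [Matrix.conjTranspose_mul] using congrArg Matrix.conjTranspose hZ
  apply hv
  rw [← Matrix.one_mulVec v, ← h3, ← Matrix.mulVec_mulVec, h1, Matrix.mulVec_zero]

/-- Since `E Y = Z - E Y₀`, expansion gives `E Y Yᴴ Eᴴ = Z Zᴴ - Eᴴ - E + E Eᴴ = E Eᴴ`, and the
invertible factors cancel. -/
theorem cayley_backward (hY₀ : Y₀ * Y₀ᴴ = 1) (hZ : Z * Y₀ᴴ = 1) (hE : E + Eᴴ = Z * Zᴴ)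
    (hY : Y = E⁻¹ * Z - Y₀) :
    Y * Yᴴ = 1 ∧ 1 + Y * Y₀ᴴ = E⁻¹ ∧ E * (Y + Y₀) = Z := by
  have hu : IsUnit E.det := isUnit_iff_ne_zero.2 (det_ne_zero_of_add_conjTranspose hZ hE)
  have hEY : E * Y = Z - E * Y₀ := by
    rw [hY, Matrix.mul_sub, ← Matrix.mul_assoc, Matrix.mul_nonsing_inv _ hu, Matrix.one_mul]
  have hZ' : Y₀ * Zᴴ = 1 := by
    simpa [Matrix.conjTranspose_mul] using congrArg Matrix.conjTranspose hZ
  refine ⟨?_, ?_, ?_⟩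
  · have h1 : E * (Y * Yᴴ) * Eᴴ = E * 1 * Eᴴ := by
      calc E * (Y * Yᴴ) * Eᴴ = (E * Y) * (E * Y)ᴴ := by
            rw [Matrix.conjTranspose_mul]; simp only [Matrix.mul_assoc]
        _ = Z * Zᴴ - Z * Y₀ᴴ * Eᴴ - E * (Y₀ * Zᴴ) + E * (Y₀ * Y₀ᴴ) * Eᴴ := by
            rw [hEY, Matrix.conjTranspose_sub, Matrix.conjTranspose_mul, Matrix.sub_mul,
              Matrix.mul_sub, Matrix.mul_sub]
            simp only [Matrix.mul_assoc]
            abel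
        _ = E * 1 * Eᴴ := by
            rw [← hE, hZ, hZ', hY₀, Matrix.one_mul, Matrix.mul_one]; abel
    have hu' : IsUnit Eᴴ.det := by rw [Matrix.det_conjTranspose]; exact hu.star
    have h2 := congrArg (fun N => E⁻¹ * N * Eᴴ⁻¹) h1
    simpa only [Matrix.mul_assoc, Matrix.mul_nonsing_inv _ hu', Matrix.mul_one,
      Matrix.nonsing_inv_mul_cancel_left _ _ hu, Matrix.one_mul] using h2
  · rw [hY, Matrix.sub_mul, hY₀, Matrix.mul_assoc, hZ, Matrix.mul_one, add_sub_cancel]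
  · rw [Matrix.mul_add, hEY, sub_add_cancel]

end Cayley

/-! ### Linear coordinates for the Cayley chart and full-rank factorization -/

section SkewCoordinates

/-- The skew-Hermitian matrix with the coordinates `T`. -/
noncomputable def skewOfReal {r : Type*} (T : r → r → ℝ) : Matrix r r ℂ :=
  Matrix.of fun i j => ⟨(T i j - T j i) / 2, (T i j + T j i) / 2⟩

theorem skewOfReal_add_conjTranspose {r : Type*} (T : r → r → ℝ) :
    skewOfReal T + (skewOfReal T)ᴴ = 0 := by
  ext i j
  apply Complex.ext <;> simp [skewOfReal] <;> ring

/-- The real coordinates of a skew-Hermitian matrix. -/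
def realOfSkew {r : Type*} (S : Matrix r r ℂ) : r → r → ℝ := fun i j => (S i j).re + (S i j).im

/-- In a skew-Hermitian matrix the real part is antisymmetric and the imaginary part symmetric, so
their sum is an arbitrary real matrix that determines both. This gives `r²` coordinates without
singling out a triangle. -/
theorem realOfSkew_skewOfReal {r : Type*} (T : r → r → ℝ) : realOfSkew (skewOfReal T) = T := by
  ext i j
  simp [realOfSkew, skewOfReal]
  ring

theorem skewOfReal_realOfSkew {r : Type*} {S : Matrix r r ℂ} (hS : S + Sᴴ = 0) :
    skewOfReal (realOfSkew S) = S := by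
  ext i j
  have h := congrFun (congrFun hS i) j
  have h1 := congrArg Complex.re h
  have h2 := congrArg Complex.im h
  simp at h1 h2
  apply Complex.ext <;> simp [realOfSkew, skewOfReal] <;> linarith

end SkewCoordinates

/-- Multiplication by the adjoint of `Y₀` as a real linear map. -/
noncomputable def mulAdjoint {r n : ℕ} (Y₀ : Matrix (Fin r) (Fin n) ℂ) :
    Ambient r n →ₗ[ℝ] Ambient r r where
  toFun B := (Matrix.of B * Y₀ᴴ : Matrix (Fin r) (Fin r) ℂ)
  map_add' B B' := Matrix.add_mul (Matrix.of B) (Matrix.of B') Y₀ᴴ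
  map_smul' c B := Matrix.smul_mul c (Matrix.of B) Y₀ᴴ

/-- Rank-nullity: the map is onto because `C = (C Y₀) Y₀ᴴ`. The additive form avoids truncated
subtraction. -/
theorem finrank_ker_mulAdjoint {r n : ℕ} {Y₀ : Matrix (Fin r) (Fin n) ℂ} (hY₀ : Y₀ * Y₀ᴴ = 1) :
    Module.finrank ℝ (LinearMap.ker (mulAdjoint Y₀)) + 2 * (r * r) = 2 * (r * n) := by
  have h1 : LinearMap.range (mulAdjoint Y₀) = ⊤ := by
    rw [LinearMap.range_eq_top]
    intro C
    refine ⟨(Matrix.of C * Y₀ : Matrix (Fin r) (Fin n) ℂ), ?_⟩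
    change Matrix.of C * Y₀ * Y₀ᴴ = Matrix.of C
    rw [Matrix.mul_assoc, hY₀, Matrix.mul_one]
  have h2 := LinearMap.finrank_range_add_finrank_ker (mulAdjoint Y₀)
  rw [h1, finrank_top] at h2
  simp only [Ambient, Module.finrank_pi_fintype, Complex.finrank_real_complex, Finset.sum_const,
    Finset.card_univ, Fintype.card_fin, smul_eq_mul] at h2 ⊢
  linarith

/-- The projection of `Z` to the matrices whose rows are orthogonal to those of `Y₀`. -/
noncomputable def orthProj {r n : ℕ} {Y₀ : Matrix (Fin r) (Fin n) ℂ} (hY₀ : Y₀ * Y₀ᴴ = 1) :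
    Ambient r n →ₗ[ℝ] LinearMap.ker (mulAdjoint Y₀) where
  toFun Z := ⟨(Matrix.of Z - Matrix.of Z * Y₀ᴴ * Y₀ : Matrix (Fin r) (Fin n) ℂ), by
    change (Matrix.of Z - Matrix.of Z * Y₀ᴴ * Y₀) * Y₀ᴴ = 0
    rw [Matrix.sub_mul, Matrix.mul_assoc _ Y₀, hY₀, Matrix.mul_one, sub_self]⟩
  map_add' Z Z' := Subtype.ext <| by
    change (Matrix.of Z + Matrix.of Z') - (Matrix.of Z + Matrix.of Z') * Y₀ᴴ * Y₀
      = (Matrix.of Z - Matrix.of Z * Y₀ᴴ * Y₀) + (Matrix.of Z' - Matrix.of Z' * Y₀ᴴ * Y₀)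
    rw [Matrix.add_mul, Matrix.add_mul]
    abel
  map_smul' c Z := Subtype.ext <| by
    change c • Matrix.of Z - (c • Matrix.of Z) * Y₀ᴴ * Y₀
      = c • (Matrix.of Z - Matrix.of Z * Y₀ᴴ * Y₀)
    rw [Matrix.smul_mul, Matrix.smul_mul, smul_sub]

/-- A positive semidefinite matrix is `L Lᴴ` with `L` of full column rank. -/
theorem exists_fullRank_factorization {k : ℕ} {A : Matrix (Fin k) (Fin k) ℂ} (hA : A.PosSemidef) :
    ∃ (L : Matrix (Fin k) (Fin A.rank) ℂ) (P : Matrix (Fin A.rank) (Fin k) ℂ),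
      P * L = 1 ∧ L * Lᴴ = A := by
  have hH := hA.isHermitian
  have hcard : Fintype.card {i // hH.eigenvalues i ≠ 0} = Fintype.card (Fin A.rank) := by
    rw [Fintype.card_fin, hH.rank_eq_card_non_zero_eigs]
  let σ : Fin A.rank ≃ {i // hH.eigenvalues i ≠ 0} := (Fintype.equivOfCardEq hcard).symm
  let V : Matrix (Fin k) (Fin k) ℂ := hH.eigenvectorUnitary
  have hV : Vᴴ * V = 1 := Matrix.mem_unitaryGroup_iff'.1 hH.eigenvectorUnitary.2
  let w : Fin k → ℝ := fun j => Real.sqrt (hH.eigenvalues j)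
  have hw : ∀ a, (w (σ a) : ℂ) ≠ 0 := fun a => by
    rw [Complex.ofReal_ne_zero]
    exact (Real.sqrt_pos.2 (lt_of_le_of_ne (hA.eigenvalues_nonneg _) (σ a).2.symm)).ne'
  -- The columns of `L` are the unit eigenvectors for nonzero eigenvalues, scaled by `√λ`; the rows
  -- of `P` are their adjoints divided by `√λ`.
  refine ⟨Matrix.of fun i a => V i (σ a) * w (σ a),
    Matrix.of fun a i => Vᴴ (σ a) i / w (σ a), ?_, ?_⟩
  · ext a b
    have h1 : ∑ i, Vᴴ (σ a) i * V i (σ b) = (1 : Matrix (Fin k) (Fin k) ℂ) (σ a) (σ b) := by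
      rw [← hV, Matrix.mul_apply]
    have h2 : ((σ a : Fin k) = σ b) ↔ a = b := by
      rw [Subtype.coe_inj, σ.injective.eq_iff]
    simp only [Matrix.mul_apply, Matrix.of_apply]
    calc ∑ i, Vᴴ (σ a) i / w (σ a) * (V i (σ b) * w (σ b))
        = (∑ i, Vᴴ (σ a) i * V i (σ b)) * (w (σ b) / w (σ a)) := by
          rw [Finset.sum_mul]
          exact Finset.sum_congr rfl fun i _ => by ring
      _ = (1 : Matrix (Fin A.rank) (Fin A.rank) ℂ) a b := by
          rw [h1, Matrix.one_apply, Matrix.one_apply]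
          simp only [h2]
          split_ifs with hab
          · rw [hab, div_self (hw b), one_mul]
          · rw [zero_mul]
  · have hspec : A = V * Matrix.diagonal (fun j => (hH.eigenvalues j : ℂ)) * Vᴴ := by
      have := hH.spectral_theorem
      rw [Unitary.conjStarAlgAut_apply] at this
      exact this
    ext i j
    have h3 : A i j = ∑ l, V i l * hH.eigenvalues l * (starRingEnd ℂ) (V j l) := by
      conv_lhs => rw [hspec]
      rw [Matrix.mul_apply]
      simp only [Matrix.mul_diagonal, Matrix.conjTranspose_apply]
      rfl
    rw [h3, Matrix.mul_apply]
    simp only [Matrix.of_apply, Matrix.conjTranspose_apply]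
    have h4 : ∀ l, V i l * w l * star (V j l * w l)
        = V i l * hH.eigenvalues l * (starRingEnd ℂ) (V j l) := fun l => by
      have : (w l : ℂ) * w l = hH.eigenvalues l := by
        rw [← Complex.ofReal_mul, Real.mul_self_sqrt (hA.eigenvalues_nonneg l)]
      rw [← this]
      simp
      ring
    simp only [h4]
    rw [σ.sum_comp (fun x => V i x * hH.eigenvalues x * (starRingEnd ℂ) (V j x))]
    rw [← Fintype.sum_subtype_add_sum_subtype (fun l => hH.eigenvalues l ≠ 0), left_eq_add]
    refine Finset.sum_eq_zero fun l _ => ?_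
    rw [not_not.1 l.2, Complex.ofReal_zero, mul_zero, zero_mul]

/-! ### Cayley charts for the solutions of `X Xᴴ = A` -/

section Chart

variable {k n r : ℕ} {A : Matrix (Fin k) (Fin k) ℂ}
  {L : Matrix (Fin k) (Fin r) ℂ} {P : Matrix (Fin r) (Fin k) ℂ}

/-- The matrix `N = (1 - L P) X` satisfies `N Nᴴ = (1 - L P) L Lᴴ (1 - L P)ᴴ = 0`, hence vanishes.
-/
theorem factor_mul_cancel (hPL : P * L = 1) (hL : L * Lᴴ = A) {X : Matrix (Fin k) (Fin n) ℂ}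
    (hX : X * Xᴴ = A) : L * (P * X) = X := by
  have h1 : (1 - L * P) * L = 0 := by
    rw [Matrix.sub_mul, Matrix.mul_assoc, hPL, Matrix.mul_one, Matrix.one_mul, sub_self]
  have h2 : ((1 - L * P) * X) * ((1 - L * P) * X)ᴴ = 0 := by
    rw [Matrix.conjTranspose_mul, Matrix.mul_assoc, ← Matrix.mul_assoc X, hX, ← hL,
      Matrix.mul_assoc L, ← Matrix.mul_assoc, h1, Matrix.zero_mul]
  rw [Matrix.self_mul_conjTranspose_eq_zero, Matrix.sub_mul, Matrix.one_mul, sub_eq_zero,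
    Matrix.mul_assoc] at h2
  exact h2.symm

theorem left_mul_conjTranspose_eq_one (hPL : P * L = 1) (hL : L * Lᴴ = A)
    {X : Matrix (Fin k) (Fin n) ℂ} (hX : X * Xᴴ = A) : (P * X) * (P * X)ᴴ = 1 := by
  have h1 : Lᴴ * Pᴴ = 1 := by rw [← Matrix.conjTranspose_mul, hPL, Matrix.conjTranspose_one]
  rw [Matrix.conjTranspose_mul, Matrix.mul_assoc, ← Matrix.mul_assoc X, hX, ← hL,
    Matrix.mul_assoc L, h1, Matrix.mul_one, hPL]

theorem mul_conjTranspose_of_factor (hL : L * Lᴴ = A) {Y : Matrix (Fin r) (Fin n) ℂ}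
    (hY : Y * Yᴴ = 1) : (L * Y) * (L * Y)ᴴ = A := by
  rw [Matrix.conjTranspose_mul, Matrix.mul_assoc, ← Matrix.mul_assoc Y, hY, Matrix.one_mul, hL]

theorem le_of_mul_conjTranspose_eq_one {Y : Matrix (Fin r) (Fin n) ℂ} (hY : Y * Yᴴ = 1) :
    r ≤ n := by
  calc r = (1 : Matrix (Fin r) (Fin r) ℂ).rank := by rw [Matrix.rank_one, Fintype.card_fin]
    _ ≤ Y.rank := hY ▸ Matrix.rank_mul_le_left Y Yᴴ
    _ ≤ n := by simpa using Y.rank_le_width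

/-- The Cayley chart around a point of a set of matrices `X Xᴴ = A`. -/
theorem exists_isSmoothChart_of_range (hPL : P * L = 1) (hL : L * Lᴴ = A) {M : Type*}
    [TopologicalSpace M] {ι : M → Ambient k n} (hι : Topology.IsEmbedding ι)
    (hrange : ∀ X : Ambient k n, X ∈ range ι ↔ Matrix.of X * (Matrix.of X)ᴴ = A) (p : M) :
    ∃ e : OpenPartialHomeomorph M (EuclideanSpace ℝ (Fin (r * (2 * n - r)))),
      IsSmoothChart (r * (2 * n - r)) ι e ∧ p ∈ e.source := by
  have hX (q : M) : Matrix.of (ι q) * (Matrix.of (ι q))ᴴ = A := (hrange _).1 ⟨q, rfl⟩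
  set Y₀ : Matrix (Fin r) (Fin n) ℂ := P * Matrix.of (ι p)
  have hY₀ : Y₀ * Y₀ᴴ = 1 := left_mul_conjTranspose_eq_one hPL hL (hX p)
  have hrn := le_of_mul_conjTranspose_eq_one hY₀
  -- The coordinate space of pairs `(S, B)`: the skew-Hermitian part of `E` in real coordinates, and
  -- `B = Z - Y₀`.
  let V := (Fin r → Fin r → ℝ) × LinearMap.ker (mulAdjoint Y₀)
  have hdim : Module.finrank ℝ V
      = Module.finrank ℝ (EuclideanSpace ℝ (Fin (r * (2 * n - r)))) := by
    have h1 := finrank_ker_mulAdjoint hY₀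
    have h2 : r * (2 * n - r) + r * r = 2 * (r * n) := by
      rw [← Nat.mul_add, Nat.sub_add_cancel (by omega)]; ring
    rw [finrank_euclideanSpace_fin, Module.finrank_prod]
    simp only [Module.finrank_pi_fintype, Module.finrank_self, Finset.sum_const,
      Finset.card_univ, Fintype.card_fin, smul_eq_mul, mul_one]
    linarith
  let Λ : V ≃L[ℝ] EuclideanSpace ℝ (Fin (r * (2 * n - r))) :=
    ContinuousLinearEquiv.ofFinrankEq hdim
  let π : Ambient r n →L[ℝ] LinearMap.ker (mulAdjoint Y₀) :=
    LinearMap.toContinuousLinearMap (orthProj hY₀)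
  -- the coordinate map
  let D (X : Ambient k n) : Matrix (Fin r) (Fin r) ℂ := 1 + P * Matrix.of X * Y₀ᴴ
  let E (X : Ambient k n) : Matrix (Fin r) (Fin r) ℂ := (D X)⁻¹
  let Z (X : Ambient k n) : Matrix (Fin r) (Fin n) ℂ := E X * (P * Matrix.of X + Y₀)
  let S (X : Ambient k n) : Matrix (Fin r) (Fin r) ℂ := E X - (2⁻¹ : ℂ) • (Z X * (Z X)ᴴ)
  let ψ (X : Ambient k n) : EuclideanSpace ℝ (Fin (r * (2 * n - r))) :=
    Λ (realOfSkew (S X), π (Z X))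
  let W : Set (Ambient k n) := {X | (D X).det ≠ 0}
  have hid (s : Set (Ambient k n)) : MatrixContDiffOn (fun X => Matrix.of X) s := fun i j => by
    simp only [Matrix.of_apply]
    fun_prop
  have hD (s : Set (Ambient k n)) : MatrixContDiffOn D s :=
    (MatrixContDiffOn.const 1).add
      (((MatrixContDiffOn.const P).mul (hid s)).mul (MatrixContDiffOn.const Y₀ᴴ))
  have hW : IsOpen W := by
    have h1 : Continuous fun X => (D X).det := (contDiffOn_univ.1 (hD univ).det).continuous
    exact isOpen_ne.preimage h1
  have hE : MatrixContDiffOn E W := (hD W).inv fun X hX => hX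
  have hZ : MatrixContDiffOn Z W :=
    hE.mul (((MatrixContDiffOn.const P).mul (hid W)).add (MatrixContDiffOn.const Y₀))
  have hS : MatrixContDiffOn S W := hE.sub ((hZ.mul hZ.conjTranspose).const_smul _)
  have hψ : ContDiffOn ℝ ∞ ψ W := by
    refine Λ.contDiff.comp_contDiffOn (ContDiffOn.prodMk ?_ ?_)
    · refine contDiffOn_pi.2 fun i => contDiffOn_pi.2 fun j => ?_
      exact (Complex.reCLM.contDiff.comp_contDiffOn (hS i j)).add
        (Complex.imCLM.contDiff.comp_contDiffOn (hS i j))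
    · exact π.contDiff.comp_contDiffOn (contDiffOn_pi.2 fun i => contDiffOn_pi.2 fun j => hZ i j)
  -- the parametrization
  let Z' (v : V) : Matrix (Fin r) (Fin n) ℂ := Y₀ + Matrix.of (v.2 : Ambient r n)
  let E' (v : V) : Matrix (Fin r) (Fin r) ℂ := (2⁻¹ : ℂ) • (Z' v * (Z' v)ᴴ) + skewOfReal v.1
  let Y' (v : V) : Matrix (Fin r) (Fin n) ℂ := (E' v)⁻¹ * Z' v - Y₀
  have hZ'1 (v : V) : Z' v * Y₀ᴴ = 1 := by
    have : Matrix.of (v.2 : Ambient r n) * Y₀ᴴ = 0 := v.2.2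
    rw [Matrix.add_mul, hY₀, this, add_zero]
  have hE'1 (v : V) : E' v + (E' v)ᴴ = Z' v * (Z' v)ᴴ := by
    have h1 := skewOfReal_add_conjTranspose v.1
    have h2 : (E' v)ᴴ = (2⁻¹ : ℂ) • (Z' v * (Z' v)ᴴ) + (skewOfReal v.1)ᴴ := by
      simp [E', Matrix.conjTranspose_add, Matrix.conjTranspose_smul, Matrix.conjTranspose_mul]
    rw [h2]
    calc _ = ((2⁻¹ : ℂ) + 2⁻¹) • (Z' v * (Z' v)ᴴ) + (skewOfReal v.1 + (skewOfReal v.1)ᴴ) := by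
          rw [add_smul]; simp only [E']; abel
      _ = _ := by rw [h1]; norm_num
  have hY' (v : V) := cayley_backward hY₀ (hZ'1 v) (hE'1 v) (rfl : Y' v = _)
  have hmem (v : V) : ∃ q, ι q = (L * Y' v : Matrix (Fin k) (Fin n) ℂ) :=
    (hrange _).2 (mul_conjTranspose_of_factor hL (hY' v).1)
  choose φ hφ using hmem
  have hZ'c : MatrixContDiffOn Z' univ := (MatrixContDiffOn.const Y₀).add fun i j => by
    have h1 : ContDiff ℝ ∞ fun v : V => (v.2 : Ambient r n) :=
      (Submodule.subtypeL (LinearMap.ker (mulAdjoint Y₀))).contDiff.comp contDiff_snd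
    exact (contDiff_pi.1 (contDiff_pi.1 h1 i) j).contDiffOn
  have hE'c : MatrixContDiffOn E' univ := by
    refine ((hZ'c.mul hZ'c.conjTranspose).const_smul _).add fun i j => ?_
    have : (fun x : V => skewOfReal x.1 i j) = fun x : V =>
        (((x.1 i j - x.1 j i) / 2 : ℝ) : ℂ) + (((x.1 i j + x.1 j i) / 2 : ℝ) : ℂ) * Complex.I := by
      ext x
      apply Complex.ext <;> simp [skewOfReal]
    rw [this]
    have h1 (i j : Fin r) : ContDiff ℝ ∞ fun x : V => x.1 i j :=
      contDiff_pi.1 (contDiff_pi.1 contDiff_fst i) j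
    exact ((Complex.ofRealCLM.contDiff.comp (((h1 i j).sub (h1 j i)).div_const 2)).add
      ((Complex.ofRealCLM.contDiff.comp (((h1 i j).add (h1 j i)).div_const 2)).mul
        contDiff_const)).contDiffOn
  have hY'c : MatrixContDiffOn (fun v => L * Y' v) univ :=
    (MatrixContDiffOn.const L).mul (((hE'c.inv fun v _ =>
      det_ne_zero_of_add_conjTranspose (hZ'1 v) (hE'1 v)).mul hZ'c).sub (MatrixContDiffOn.const Y₀))
  have hφc : ContDiff ℝ ∞ (fun x => ι (φ (Λ.symm x))) := by
    have h1 : ContDiff ℝ ∞ (fun v => ι (φ v)) := by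
      refine contDiff_pi.2 fun i => contDiff_pi.2 fun j => ?_
      simp only [hφ]
      exact contDiffOn_univ.1 (hY'c i j)
    exact h1.comp Λ.symm.contDiff
  have hPφ (v : V) : P * Matrix.of (ι (φ v)) = Y' v := by
    rw [hφ]
    change P * (L * Y' v) = Y' v
    rw [← Matrix.mul_assoc, hPL, Matrix.one_mul]
  -- In particular `D` is invertible at every parametrized point, so the parametrization never
  -- leaves `W`.
  have hDφ (v : V) : D (ι (φ v)) = (E' v)⁻¹ := by
    change 1 + P * Matrix.of (ι (φ v)) * Y₀ᴴ = _
    rw [hPφ, (hY' v).2.1]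
  have hE'u (v : V) : IsUnit (E' v).det :=
    isUnit_iff_ne_zero.2 (det_ne_zero_of_add_conjTranspose (hZ'1 v) (hE'1 v))
  have hEφ (v : V) : E (ι (φ v)) = E' v := by
    change (D (ι (φ v)))⁻¹ = _
    rw [hDφ, Matrix.nonsing_inv_nonsing_inv _ (hE'u v)]
  have hZφ (v : V) : Z (ι (φ v)) = Z' v := by
    change E (ι (φ v)) * (P * Matrix.of (ι (φ v)) + Y₀) = _
    rw [hEφ, hPφ, (hY' v).2.2]
  have hψφ (v : V) : ψ (ι (φ v)) = Λ v := by
    refine congrArg Λ (Prod.ext ?_ (Subtype.ext ?_))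
    · change realOfSkew (E (ι (φ v)) - (2⁻¹ : ℂ) • (Z (ι (φ v)) * (Z (ι (φ v)))ᴴ)) = _
      rw [hEφ, hZφ, add_sub_cancel_left, realOfSkew_skewOfReal]
    · change Z (ι (φ v)) - Z (ι (φ v)) * Y₀ᴴ * Y₀ = Matrix.of (v.2 : Ambient r n)
      rw [hZφ, hZ'1, Matrix.one_mul, add_sub_cancel_left]
  have hφψ (q : M) (hq : ι q ∈ W) : φ (Λ.symm (ψ (ι q))) = q := by
    apply hι.injective
    obtain ⟨h1, h2, h3⟩ := cayley_forward (E := E (ι q)) (Z := Z (ι q))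
      (left_mul_conjTranspose_eq_one hPL hL (hX q)) hY₀ hq rfl rfl
    rw [hφ, Λ.symm_apply_apply]
    have h4 : Z' (realOfSkew (S (ι q)), π (Z (ι q))) = Z (ι q) := by
      change Y₀ + (Z (ι q) - Z (ι q) * Y₀ᴴ * Y₀) = Z (ι q)
      rw [h1, Matrix.one_mul, add_sub_cancel]
    have h5 : S (ι q) + (S (ι q))ᴴ = 0 := by
      have h6 : (S (ι q))ᴴ = (E (ι q))ᴴ - (2⁻¹ : ℂ) • (Z (ι q) * (Z (ι q))ᴴ) := by
        simp [S, Matrix.conjTranspose_sub, Matrix.conjTranspose_smul, Matrix.conjTranspose_mul]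
      rw [h6]
      calc _ = (E (ι q) + (E (ι q))ᴴ) - ((2⁻¹ : ℂ) + 2⁻¹) • (Z (ι q) * (Z (ι q))ᴴ) := by
            rw [add_smul]; simp only [S]; abel
        _ = 0 := by rw [h2]; norm_num
    have h7 : E' (realOfSkew (S (ι q)), π (Z (ι q))) = E (ι q) := by
      change (2⁻¹ : ℂ) • (Z' (realOfSkew (S (ι q)), π (Z (ι q)))
        * (Z' (realOfSkew (S (ι q)), π (Z (ι q))))ᴴ) + skewOfReal (realOfSkew (S (ι q))) = E (ι q)
      rw [h4, skewOfReal_realOfSkew h5, add_sub_cancel]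
    change L * ((E' (realOfSkew (S (ι q)), π (Z (ι q))))⁻¹
      * Z' (realOfSkew (S (ι q)), π (Z (ι q))) - Y₀) = Matrix.of (ι q)
    rw [h7, h4, h3, factor_mul_cancel hPL hL (hX q)]
  obtain ⟨e, he, hes⟩ := exists_isSmoothChart hι hW hψ (φ := fun x => φ (Λ.symm x)) hφc
    (fun x => by
      change (D (ι (φ (Λ.symm x)))).det ≠ 0
      rw [hDφ]
      exact (Matrix.isUnit_nonsing_inv_det _ (hE'u _)).ne_zero)
    (fun x => by rw [hψφ, Λ.apply_symm_apply]) hφψ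
  refine ⟨e, he, ?_⟩
  rw [hes]
  -- At the base point `D = 2 · 1`, so `p` lies in its own chart domain.
  change (1 + Y₀ * Y₀ᴴ).det ≠ 0
  rw [hY₀, one_add_one_eq_two]
  have : (2 : Matrix (Fin r) (Fin r) ℂ) = (2 : ℂ) • 1 := by
    rw [← one_add_one_eq_two, ← one_add_one_eq_two, add_smul, one_smul]
  rw [this, Matrix.det_smul, Matrix.det_one, mul_one]
  exact pow_ne_zero _ two_ne_zero

end Chart

/-! ### Submanifold structure and compactness -/

section Range

variable {k n : ℕ} {A : Matrix (Fin k) (Fin k) ℂ} {M : Type*} [TopologicalSpace M]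
  {ι : M → Ambient k n}

/-- Only the range of the embedding matters, so the same charts serve the generalized Stiefel
manifold and, with `A = 1`, the unitary group. -/
theorem isSmoothSubmanifold_of_range (hA : A.PosSemidef) (hι : Topology.IsEmbedding ι)
    (hrange : ∀ X : Ambient k n, X ∈ range ι ↔ Matrix.of X * (Matrix.of X)ᴴ = A) :
    IsSmoothSubmanifold (A.rank * (2 * n - A.rank)) ι := by
  obtain ⟨L, P, hPL, hL⟩ := exists_fullRank_factorization hA
  exact ⟨hι, exists_isSmoothChart_of_range hPL hL hι hrange⟩

/-- The equation is closed, and its diagonal entries fix the Euclidean norms of the rows of `X`. The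
radius uses `t ≤ 1 + t²` in place of a square root. -/
theorem compactSpace_of_range (hι : Topology.IsEmbedding ι)
    (hrange : ∀ X : Ambient k n, X ∈ range ι ↔ Matrix.of X * (Matrix.of X)ᴴ = A) :
    CompactSpace M := by
  rw [← isCompact_univ_iff, hι.isCompact_iff, image_univ]
  have hset : range ι = {X : Ambient k n | Matrix.of X * (Matrix.of X)ᴴ = A} := Set.ext hrange
  rw [hset]
  refine Metric.isCompact_of_isClosed_isBounded ?_ ?_
  · have h1 : Continuous fun X : Ambient k n => Matrix.of X * (Matrix.of X)ᴴ :=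
      continuous_matrix fun i j => by
        simp only [Matrix.mul_apply, Matrix.conjTranspose_apply, Matrix.of_apply]
        fun_prop
    exact isClosed_eq h1 continuous_const
  · refine (Metric.isBounded_closedBall (x := (0 : Ambient k n))
      (r := ∑ i, (1 + ‖A i i‖))).subset fun X hX => ?_
    have hnn : 0 ≤ ∑ i, (1 + ‖A i i‖) := Finset.sum_nonneg fun i _ => by positivity
    rw [mem_closedBall_zero_iff, pi_norm_le_iff_of_nonneg hnn]
    refine fun i => (pi_norm_le_iff_of_nonneg hnn).2 fun j => ?_
    have h1 : ∑ j, ((‖X i j‖ ^ 2 : ℝ) : ℂ) = A i i := by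
      rw [← congrFun (congrFun hX i) i, Matrix.mul_apply]
      refine Finset.sum_congr rfl fun j _ => ?_
      simp [Complex.mul_conj, Complex.normSq_eq_norm_sq]
    have h2 : ∑ j, ‖X i j‖ ^ 2 = ‖A i i‖ := by
      rw [← h1, ← Complex.ofReal_sum, Complex.norm_real, Real.norm_of_nonneg]
      positivity
    have h3 : ‖X i j‖ ^ 2 ≤ ‖A i i‖ :=
      h2 ▸ Finset.single_le_sum (f := fun j => ‖X i j‖ ^ 2) (fun j _ => by positivity)
        (Finset.mem_univ j)
    calc ‖X i j‖ ≤ 1 + ‖A i i‖ := by nlinarith [sq_nonneg (‖X i j‖ - 1), norm_nonneg (X i j)]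
      _ ≤ ∑ i, (1 + ‖A i i‖) := Finset.single_le_sum (f := fun i => 1 + ‖A i i‖)
        (fun i _ => by positivity) (Finset.mem_univ i)

end Range

/-! ### The Stiefel manifold and the unitary group as submanifolds -/

section Embeddings

variable {k n : ℕ} {A : Matrix (Fin k) (Fin k) ℂ}

theorem isEmbedding_incl : Topology.IsEmbedding (incl A n) := Topology.IsEmbedding.subtypeVal

theorem range_incl (X : Ambient k n) :
    X ∈ range (incl A n) ↔ Matrix.of X * (Matrix.of X)ᴴ = A :=
  ⟨fun ⟨Y, hY⟩ => hY ▸ Y.2, fun h => ⟨⟨Matrix.of X, h⟩, rfl⟩⟩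

theorem isEmbedding_unitaryIncl : Topology.IsEmbedding (unitaryIncl n) :=
  Topology.IsEmbedding.subtypeVal

theorem range_unitaryIncl (X : Ambient n n) :
    X ∈ range (unitaryIncl n) ↔ Matrix.of X * (Matrix.of X)ᴴ = 1 :=
  ⟨fun ⟨Y, hY⟩ => hY ▸ Matrix.mem_unitaryGroup_iff.1 Y.2,
    fun h => ⟨⟨Matrix.of X, Matrix.mem_unitaryGroup_iff.2 h⟩, rfl⟩⟩

theorem isSmoothSubmanifold_incl (hA : A.PosSemidef) :
    IsSmoothSubmanifold (stiefelDim A n) (incl A n) :=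
  isSmoothSubmanifold_of_range hA isEmbedding_incl range_incl

theorem isSmoothSubmanifold_unitaryIncl : IsSmoothSubmanifold (n ^ 2) (unitaryIncl n) := by
  have h := isSmoothSubmanifold_of_range Matrix.PosSemidef.one isEmbedding_unitaryIncl
    (range_unitaryIncl (n := n))
  rwa [Matrix.rank_one, Fintype.card_fin, two_mul, Nat.add_sub_cancel, ← sq] at h

instance : CompactSpace (Stiefel A n) := compactSpace_of_range isEmbedding_incl range_incl

instance : CompactSpace (U n) := compactSpace_of_range isEmbedding_unitaryIncl range_unitaryIncl

instance : SecondCountableTopology (Stiefel A n) := isEmbedding_incl.secondCountableTopology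

instance : SecondCountableTopology (U n) := isEmbedding_unitaryIncl.secondCountableTopology

end Embeddings

/-! ### The action of the unitary group -/

section Action

variable {k n : ℕ} {A : Matrix (Fin k) (Fin k) ℂ}

theorem rightMul_one (X : Stiefel A n) : rightMul X 1 = X :=
  Subtype.ext (Matrix.mul_one X.1)

theorem rightMul_mul (X : Stiefel A n) (V W : U n) :
    rightMul X (V * W) = rightMul (rightMul X V) W :=
  Subtype.ext (Matrix.mul_assoc X.1 V.1 W.1).symm

theorem continuous_rightMul :
    Continuous fun q : Stiefel A n × U n => rightMul q.1 q.2 :=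
  Continuous.subtype_mk ((continuous_subtype_val.comp continuous_fst).matrix_mul
    (continuous_subtype_val.comp continuous_snd)) _

theorem continuous_leftMul {m : ℕ} (K : Matrix (Fin m) (Fin k) ℂ) :
    Continuous (leftMul K : Stiefel A n → Stiefel (K * A * Kᴴ) n) :=
  Continuous.subtype_mk (continuous_const.matrix_mul continuous_subtype_val) _

theorem continuous_rightMul_const (V : U n) : Continuous fun X : Stiefel A n => rightMul X V :=
  continuous_rightMul.comp (continuous_id.prodMk continuous_const)

theorem leftMul_rightMul {m : ℕ} (K : Matrix (Fin m) (Fin k) ℂ) (X : Stiefel A n) (V : U n) :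
    leftMul K (rightMul X V) = rightMul (leftMul K X) V :=
  Subtype.ext (Matrix.mul_assoc K X.1 V.1).symm

/-- Right multiplication by a unitary matrix as a homeomorphism of the Stiefel manifold. -/
def rightMulHomeomorph (A : Matrix (Fin k) (Fin k) ℂ) (V : U n) : Stiefel A n ≃ₜ Stiefel A n where
  toFun X := rightMul X V
  invFun X := rightMul X V⁻¹
  left_inv X := by
    change rightMul (rightMul X V) V⁻¹ = X
    rw [← rightMul_mul, mul_inv_cancel, rightMul_one]
  right_inv X := by
    change rightMul (rightMul X V⁻¹) V = X
    rw [← rightMul_mul, inv_mul_cancel, rightMul_one]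
  continuous_toFun := continuous_rightMul_const V
  continuous_invFun := continuous_rightMul_const V⁻¹

theorem coe_mul_coe_inv (V : U n) : V.1 * (V⁻¹).1 = 1 :=
  congrArg Subtype.val (mul_inv_cancel V)

theorem coe_inv_mul_coe (V : U n) : (V⁻¹).1 * V.1 = 1 :=
  congrArg Subtype.val (inv_mul_cancel V)

/-- Right multiplication by a unitary matrix on the ambient space. -/
noncomputable def ambientRightMul (k : ℕ) (V : U n) : Ambient k n ≃L[ℝ] Ambient k n :=
  LinearEquiv.toContinuousLinearEquiv
    { toFun := fun X => (Matrix.of X * V.1 : Matrix (Fin k) (Fin n) ℂ)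
      invFun := fun X => (Matrix.of X * (V⁻¹).1 : Matrix (Fin k) (Fin n) ℂ)
      map_add' := fun X Y => Matrix.add_mul (Matrix.of X) (Matrix.of Y) V.1
      map_smul' := fun c X => Matrix.smul_mul c (Matrix.of X) V.1
      left_inv := fun X => by
        change Matrix.of X * V.1 * (V⁻¹).1 = Matrix.of X
        rw [Matrix.mul_assoc, coe_mul_coe_inv, Matrix.mul_one]
      right_inv := fun X => by
        change Matrix.of X * (V⁻¹).1 * V.1 = Matrix.of X
        rw [Matrix.mul_assoc, coe_inv_mul_coe, Matrix.mul_one] }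

theorem incl_rightMul (V : U n) (X : Stiefel A n) :
    incl A n (rightMul X V) = ambientRightMul k V (incl A n X) := rfl

theorem frobInner_ambientRightMul (V : U n) (X Y : Ambient k n) :
    frobInner (ambientRightMul k V X) (ambientRightMul k V Y) = frobInner X Y := by
  change ((Matrix.of X * V.1) * (Matrix.of Y * V.1)ᴴ).trace.re
    = (Matrix.of X * (Matrix.of Y)ᴴ).trace.re
  have h : V.1 * V.1ᴴ = 1 := Matrix.mem_unitaryGroup_iff.1 V.2
  rw [Matrix.conjTranspose_mul, Matrix.mul_assoc, ← Matrix.mul_assoc V.1, h, Matrix.one_mul]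

/-- Orthonormal rows can be completed to a unitary matrix. -/
theorem exists_unitary_extension {r : ℕ} (hrn : r ≤ n) {Y : Matrix (Fin r) (Fin n) ℂ}
    (hY : Y * Yᴴ = 1) : ∃ V : U n, V.1.submatrix (Fin.castLE hrn) id = Y := by
  -- The zero vectors are padding: the basis extension retains only the values at indices below `r`.
  let v (a : Fin n) : EuclideanSpace ℂ (Fin n) :=
    if h : a.1 < r then WithLp.toLp 2 (Y ⟨a, h⟩) else 0
  have hinner (X Z : Fin n → ℂ) :
      inner ℂ (WithLp.toLp 2 X : EuclideanSpace ℂ (Fin n)) (WithLp.toLp 2 Z)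
        = ∑ j, Z j * star (X j) := by
    simp [PiLp.inner_apply]
  have hv : Orthonormal ℂ (({a : Fin n | a.1 < r}).domRestrict v) := by
    rw [orthonormal_iff_ite]
    rintro ⟨a, ha⟩ ⟨b, hb⟩
    have ha' : a.1 < r := ha
    have hb' : b.1 < r := hb
    have h1 : v a = WithLp.toLp 2 (Y ⟨a, ha'⟩) := dif_pos ha'
    have h2 : v b = WithLp.toLp 2 (Y ⟨b, hb'⟩) := dif_pos hb'
    change inner ℂ (v a) (v b) = _
    rw [h1, h2, hinner]
    -- The inner product is conjugate-linear in its first argument, so the pair `(a, b)` corresponds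
    -- to the entry `(b, a)` of `Y Yᴴ`.
    have h3 := congrFun (congrFun hY ⟨b, hb'⟩) ⟨a, ha'⟩
    rw [Matrix.mul_apply] at h3
    simp only [Matrix.conjTranspose_apply] at h3
    rw [h3, Matrix.one_apply]
    simp [Fin.ext_iff, eq_comm]
  obtain ⟨b, hb⟩ := hv.exists_orthonormalBasis_extension_of_card_eq (by simp)
  have hV : (Matrix.of fun a j => b a j) ∈ Matrix.unitaryGroup (Fin n) ℂ := by
    rw [Matrix.mem_unitaryGroup_iff]
    ext a c
    have h1 := orthonormal_iff_ite.1 b.orthonormal c a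
    have h2 := hinner (b c).ofLp (b a).ofLp
    rw [Matrix.mul_apply, Matrix.one_apply]
    simp only [Matrix.star_apply, Matrix.of_apply]
    rw [← h2]
    simp only [WithLp.toLp_ofLp, h1, eq_comm]
  refine ⟨⟨_, hV⟩, ?_⟩
  ext i j
  have h1 : b (Fin.castLE hrn i) = v (Fin.castLE hrn i) := hb _ i.2
  have h2 : v (Fin.castLE hrn i) = WithLp.toLp 2 (Y i) := dif_pos i.2
  simp [h1, h2]

theorem exists_mul_unitary_eq {r : ℕ} {Y Y' : Matrix (Fin r) (Fin n) ℂ} (hY : Y * Yᴴ = 1)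
    (hY' : Y' * Y'ᴴ = 1) : ∃ V : U n, Y * V.1 = Y' := by
  have hrn := le_of_mul_conjTranspose_eq_one hY
  obtain ⟨V, hV⟩ := exists_unitary_extension hrn hY
  obtain ⟨V', hV'⟩ := exists_unitary_extension hrn hY'
  refine ⟨V⁻¹ * V', ?_⟩
  have h1 : V.1 * (V⁻¹ * V').1 = V'.1 := congrArg Subtype.val (mul_inv_cancel_left V V')
  rw [← hV, ← hV']
  ext i j
  have h2 := congrFun (congrFun h1 (Fin.castLE hrn i)) j
  rw [Matrix.mul_apply] at h2 ⊢
  exact h2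

/-- A unitary matrix carrying the orthonormal rows `P X` to `P X'` carries `X = L P X` to `X' = L P
X'`. -/
theorem exists_rightMul_eq (hA : A.PosSemidef) (X X' : Stiefel A n) :
    ∃ V : U n, rightMul X V = X' := by
  obtain ⟨L, P, hPL, hL⟩ := exists_fullRank_factorization hA
  obtain ⟨V, hV⟩ := exists_mul_unitary_eq (left_mul_conjTranspose_eq_one hPL hL X.2)
    (left_mul_conjTranspose_eq_one hPL hL X'.2)
  refine ⟨V, Subtype.ext ?_⟩
  change X.1 * V.1 = X'.1
  rw [← factor_mul_cancel hPL hL X.2, ← factor_mul_cancel hPL hL X'.2, Matrix.mul_assoc, hV]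

/-- The bound on the rank leaves room for `A.rank` orthonormal rows, here the first rows of the
identity. -/
theorem nonempty_stiefel (hA : A.PosSemidef) (hn : A.rank ≤ n) : Nonempty (Stiefel A n) := by
  obtain ⟨L, P, -, hL⟩ := exists_fullRank_factorization hA
  let Y : Matrix (Fin A.rank) (Fin n) ℂ :=
    (1 : Matrix (Fin n) (Fin n) ℂ).submatrix (Fin.castLE hn) id
  have hY : Y * Yᴴ = 1 := by
    ext i j
    simp [Y, Matrix.mul_apply, Matrix.one_apply]
  exact ⟨⟨L * Y, mul_conjTranspose_of_factor hL hY⟩⟩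

end Action

/-! ### Smoothness of the action -/

section Smooth

variable {k n : ℕ} {A : Matrix (Fin k) (Fin k) ℂ}

theorem contDiff_ambient_mul {m : ℕ} : ContDiff ℝ ∞ fun q : Ambient k n × Ambient n m =>
    (fun i j => ∑ a, q.1 i a * q.2 a j : Ambient k m) := by
  fun_prop

theorem contDiff_ambient_conjTranspose :
    ContDiff ℝ ∞ fun X : Ambient n n => (fun i j => star (X j i) : Ambient n n) := by
  refine contDiff_pi.2 fun i => contDiff_pi.2 fun j => ?_
  exact Complex.conjCLE.contDiff.comp (contDiff_pi.1 (contDiff_pi.1 contDiff_id j) i)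

theorem lieGroup_unitary (hU : IsSmoothSubmanifold (n ^ 2) (unitaryIncl n)) :
    letI := hU.chartedSpace
    LieGroup (𝓡 (n ^ 2)) ∞ (U n) := by
  let _ := hU.chartedSpace
  have hM : IsManifold (𝓡 (n ^ 2)) ∞ (U n) := hU.isManifold
  have hinc := hU.contMDiff_incl
  exact
    { hM with
      contMDiff_mul := by
        refine hU.contMDiff_of_comp ?_
        have h := contDiff_ambient_mul.contMDiff.comp
          ((hinc.comp contMDiff_fst).prodMk_space (hinc.comp contMDiff_snd))
        refine h.congr fun q => ?_
        ext i j
        simp [unitaryIncl, Matrix.mul_apply]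
      contMDiff_inv := by
        refine hU.contMDiff_of_comp ?_
        exact contDiff_ambient_conjTranspose.contMDiff.comp hinc }

theorem contMDiff_rightMul (hU : IsSmoothSubmanifold (n ^ 2) (unitaryIncl n))
    (hS : IsSmoothSubmanifold (stiefelDim A n) (incl A n)) :
    letI := hU.chartedSpace
    letI := hS.chartedSpace
    ContMDiff ((𝓡 (stiefelDim A n)).prod (𝓡 (n ^ 2))) (𝓡 (stiefelDim A n)) ∞
      (fun p : Stiefel A n × U n => rightMul p.1 p.2) := by
  let _ := hU.chartedSpace
  let _ := hS.chartedSpace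
  refine hS.contMDiff_of_comp ?_
  have h := contDiff_ambient_mul.contMDiff.comp
    ((hS.contMDiff_incl.comp contMDiff_fst).prodMk_space (hU.contMDiff_incl.comp contMDiff_snd))
  refine h.congr fun q => ?_
  ext i j
  simp [unitaryIncl, incl, rightMul, Matrix.mul_apply]

theorem isHomogeneousSpace_stiefel (hA : A.PosSemidef) (hn : A.rank ≤ n)
    (hU : IsSmoothSubmanifold (n ^ 2) (unitaryIncl n))
    (hS : IsSmoothSubmanifold (stiefelDim A n) (incl A n)) :
    letI := hU.chartedSpace
    letI := hS.chartedSpace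
    IsHomogeneousSpace (d := stiefelDim A n) (e := n ^ 2)
      (rightMul : Stiefel A n → U n → Stiefel A n) := by
  let _ := hU.chartedSpace
  let _ := hS.chartedSpace
  exact
    { isManifold := hS.isManifold
      lieGroup := lieGroup_unitary hU
      nonempty := nonempty_stiefel hA hn
      act_one := rightMul_one
      act_mul := rightMul_mul
      smooth := contMDiff_rightMul hU hS
      transitive := exists_rightMul_eq hA }

/-- Differentiating `incl ∘ (· V) = ambientRightMul ∘ incl` shows that tangent matrices are also
multiplied by `V` on the right, and this preserves the trace form since `V Vᴴ = 1`. -/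
theorem metric_rightMul (hS : IsSmoothSubmanifold (stiefelDim A n) (incl A n)) :
    letI := hS.chartedSpace
    ∀ (V : U n) (X : Stiefel A n) (v w : TangentSpace (𝓡 (stiefelDim A n)) X),
      metric (d := stiefelDim A n) (rightMul X V)
        (mfderiv (𝓡 (stiefelDim A n)) (𝓡 (stiefelDim A n)) (fun Y => rightMul Y V) X v)
        (mfderiv (𝓡 (stiefelDim A n)) (𝓡 (stiefelDim A n)) (fun Y => rightMul Y V) X w)
      = metric (d := stiefelDim A n) X v w := by
  let _ := hS.chartedSpace
  intro V X v w
  have hinc : MDifferentiable (𝓡 (stiefelDim A n)) 𝓘(ℝ, Ambient k n) (incl A n) :=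
    hS.contMDiff_incl.mdifferentiable (by simp)
  have hR : MDifferentiable (𝓡 (stiefelDim A n)) (𝓡 (stiefelDim A n))
      (fun Y : Stiefel A n => rightMul Y V) := by
    refine ContMDiff.mdifferentiable (n := ∞) (hS.contMDiff_of_comp ?_) (by simp)
    exact (ambientRightMul k V).contDiff.contMDiff.comp hS.contMDiff_incl
  have key (u : TangentSpace (𝓡 (stiefelDim A n)) X) :
      (mfderiv (𝓡 (stiefelDim A n)) 𝓘(ℝ, Ambient k n) (incl A n) (rightMul X V)
        (mfderiv (𝓡 (stiefelDim A n)) (𝓡 (stiefelDim A n)) (fun Y => rightMul Y V) X u) :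
        Ambient k n)
      = ambientRightMul k V
        (mfderiv (𝓡 (stiefelDim A n)) 𝓘(ℝ, Ambient k n) (incl A n) X u : Ambient k n) := by
    have h1 := mfderiv_comp_apply (f := fun Y : Stiefel A n => rightMul Y V) X
      (hinc (rightMul X V)) (hR X) u
    have h2 := mfderiv_comp_apply (I' := 𝓘(ℝ, Ambient k n)) (I'' := 𝓘(ℝ, Ambient k n))
      (g := ambientRightMul k V) (f := incl A n) X
      (ambientRightMul k V).differentiableAt.mdifferentiableAt (hinc X) u
    rw [mfderiv_eq_fderiv, (ambientRightMul k V).fderiv] at h2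
    exact h1.symm.trans h2
  simp only [metric]
  rw [key, key]
  exact frobInner_ambientRightMul V _ _

end Smooth

/-- A compact group acting transitively leaves at most one probability measure invariant. -/
theorem eq_of_invariant_of_transitive {G M : Type*} [Group G] [TopologicalSpace G]
    [IsTopologicalGroup G] [CompactSpace G] [SecondCountableTopology G]
    [TopologicalSpace M] [MeasurableSpace M] [BorelSpace M] {act : M → G → M}
    (hact : Continuous fun p : M × G => act p.1 p.2)
    (hmul : ∀ x g h, act x (g * h) = act (act x g) h) (htrans : ∀ x y, ∃ g, act x g = y)
    {μ ν : Measure M} [IsProbabilityMeasure μ] [IsProbabilityMeasure ν]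
    (hμ : ∀ g, μ.map (fun x => act x g) = μ) (hν : ∀ g, ν.map (fun x => act x g) = ν) :
    μ = ν := by
  let _ : MeasurableSpace G := borel G
  have : BorelSpace G := ⟨rfl⟩
  let H : Measure G := Measure.haar
  have hH0 : H univ ≠ 0 := isOpen_univ.measure_ne_zero H univ_nonempty
  have hHtop : H univ ≠ ⊤ := isCompact_univ.measure_ne_top
  obtain ⟨x₀⟩ : Nonempty M := nonempty_of_isProbabilityMeasure μ
  have hg (g : G) : Measurable fun x => act x g :=
    (hact.comp (continuous_id.prodMk continuous_const)).measurable
  -- The right-hand side does not mention `ρ`, so it determines every invariant probability.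
  -- Integrate the indicator of `s` at `act x g` over both variables: the inner integral over `x` is
  -- `ρ s` by invariance, the one over `g` does not depend on `x`.
  have key (ρ : Measure M) [IsProbabilityMeasure ρ] (hρ : ∀ g, ρ.map (fun x => act x g) = ρ)
      (s : Set M) (hs : MeasurableSet s) :
      ρ s * H univ = ∫⁻ g, s.indicator 1 (act x₀ g) ∂H := by
    have hf : Measurable (s.indicator (1 : M → ℝ≥0∞)) := measurable_one.indicator hs
    have h1 (g : G) : ∫⁻ x, s.indicator 1 (act x g) ∂ρ = ρ s := by
      rw [← lintegral_map hf (hg g), hρ g, lintegral_indicator_one hs]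
    have h2 (x : M) : ∫⁻ g, s.indicator (1 : M → ℝ≥0∞) (act x g) ∂H
        = ∫⁻ g, s.indicator (1 : M → ℝ≥0∞) (act x₀ g) ∂H := by
      -- For a right action, moving the base point from `x₀` to `act x₀ a` is left translation by
      -- `a`, under which Haar measure is invariant.
      obtain ⟨a, rfl⟩ := htrans x₀ x
      simp only [← hmul]
      exact lintegral_mul_left_eq_self (fun g => s.indicator (1 : M → ℝ≥0∞) (act x₀ g)) a
    calc ρ s * H univ = ∫⁻ g, ∫⁻ x, s.indicator 1 (act x g) ∂ρ ∂H := by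
          simp only [h1, lintegral_const]
      _ = ∫⁻ x, ∫⁻ g, s.indicator 1 (act x g) ∂H ∂ρ :=
          lintegral_lintegral_swap
            (hf.comp (hact.comp continuous_swap).measurable).aemeasurable
      _ = ∫⁻ g, s.indicator 1 (act x₀ g) ∂H := by
          simp only [h2, lintegral_const, measure_univ, mul_one]
  ext s hs
  have h := (key μ hμ s hs).trans (key ν hν s hs).symm
  exact (ENNReal.mul_left_inj hH0 hHtop).1 h

/-! ### The uniform distribution and its images under left multiplication -/

section Uniform

variable {k n : ℕ} {A : Matrix (Fin k) (Fin k) ℂ}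

theorem eq_of_isInvariant (hA : A.PosSemidef) {μ ν : Measure (Stiefel A n)}
    [IsProbabilityMeasure μ] [IsProbabilityMeasure ν] (hμ : IsInvariant μ) (hν : IsInvariant ν) :
    μ = ν :=
  eq_of_invariant_of_transitive continuous_rightMul rightMul_mul (exists_rightMul_eq hA) hμ hν

theorem isInvariant_vol : IsInvariant (Vol A n) := fun V =>
  map_riemannianVolume (rightMulHomeomorph A V) (ambientRightMul k V)
    (frobInner_ambientRightMul V) (incl_rightMul V)

theorem vol_univ_pos (hA : A.PosSemidef) (hn : A.rank ≤ n) : 0 < Vol A n univ :=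
  have := nonempty_stiefel hA hn
  (isSmoothSubmanifold_incl hA).riemannianVolume_univ_pos

theorem vol_univ_lt_top (hA : A.PosSemidef) : Vol A n univ < ⊤ :=
  (isSmoothSubmanifold_incl hA).riemannianVolume_univ_lt_top

theorem isProbabilityMeasure_uniform (hA : A.PosSemidef) (hn : A.rank ≤ n) :
    IsProbabilityMeasure (uniform A n) :=
  ⟨ENNReal.inv_mul_cancel (vol_univ_pos hA hn).ne' (vol_univ_lt_top hA).ne⟩

theorem isInvariant_uniform : IsInvariant (uniform A n) := fun V => by
  rw [uniform, Measure.map_smul, isInvariant_vol V]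

/-- Left and right multiplication commute, so the image measure is an invariant probability, and
uniqueness on the target identifies it. Neither injectivity nor surjectivity of `K` plays a role,
although the dimension of the manifold may drop. -/
theorem map_leftMul_uniform (hA : A.PosSemidef) (hn : A.rank ≤ n) {m : ℕ}
    (K : Matrix (Fin m) (Fin k) ℂ) :
    (uniform A n).map (leftMul K) = uniform (K * A * Kᴴ) n := by
  have hA' : (K * A * Kᴴ).PosSemidef := hA.mul_mul_conjTranspose_same K
  have hn' : (K * A * Kᴴ).rank ≤ n :=
    ((Matrix.rank_mul_le_left _ _).trans (Matrix.rank_mul_le_right _ _)).trans hn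
  have := isProbabilityMeasure_uniform hA hn
  have := isProbabilityMeasure_uniform hA' hn'
  have hK : Measurable (leftMul K : Stiefel A n → _) := (continuous_leftMul K).measurable
  have := Measure.isProbabilityMeasure_map (μ := uniform A n) hK.aemeasurable
  refine eq_of_isInvariant hA' (fun V => ?_) isInvariant_uniform
  rw [Measure.map_map (continuous_rightMul_const V).measurable hK]
  have h : (fun X => rightMul X V) ∘ (leftMul K : Stiefel A n → _)
      = leftMul K ∘ fun X => rightMul X V := funext fun X => (leftMul_rightMul K X V).symm
  rw [h, ← Measure.map_map hK (continuous_rightMul_const V).measurable, isInvariant_uniform V]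

end Uniform

end GenStiefel

open GenStiefel in
theorem proposition1 {k n : ℕ} (A : Matrix (Fin k) (Fin k) ℂ) (hA : A.PosSemidef)
    (hn : A.rank < n) :
    -- (a) homogeneous space and invariance of the metric
    (∃ (hU : IsSmoothSubmanifold (n ^ 2) (unitaryIncl n))
       (hS : IsSmoothSubmanifold (stiefelDim A n) (incl A n)),
      letI := hU.chartedSpace
      letI := hS.chartedSpace
      IsHomogeneousSpace (d := stiefelDim A n) (e := n ^ 2)
          (rightMul : Stiefel A n → U n → Stiefel A n) ∧
        ∀ (V : U n) (X : Stiefel A n) (v w : TangentSpace (𝓡 (stiefelDim A n)) X),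
          metric (d := stiefelDim A n) (rightMul X V)
            (mfderiv (𝓡 (stiefelDim A n)) (𝓡 (stiefelDim A n)) (fun Y => rightMul Y V) X v)
            (mfderiv (𝓡 (stiefelDim A n)) (𝓡 (stiefelDim A n)) (fun Y => rightMul Y V) X w)
          = metric (d := stiefelDim A n) X v w) ∧
    -- (a) invariance of the volume
    IsInvariant (Vol A n) ∧
    -- (a) the normalized volume is the unique invariant probability measure
    (0 < Vol A n univ ∧ Vol A n univ < ⊤ ∧ IsProbabilityMeasure (uniform A n) ∧
      IsInvariant (uniform A n) ∧
      ∀ μ : Measure (Stiefel A n), IsProbabilityMeasure μ → IsInvariant μ → μ = uniform A n) ∧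
    -- (b) the image of the uniform distribution under left multiplication is uniform
    (∀ {m : ℕ} (K : Matrix (Fin m) (Fin k) ℂ) {Ω : Type*} [MeasurableSpace Ω] (P : Measure Ω)
      [IsProbabilityMeasure P] (F : Ω → Stiefel A n),
      HasLaw F (uniform A n) P →
        HasLaw (fun t => leftMul K (F t)) (uniform (K * A * Kᴴ) n) P) := by
  refine ⟨⟨isSmoothSubmanifold_unitaryIncl, isSmoothSubmanifold_incl hA,
      isHomogeneousSpace_stiefel hA hn.le _ _, metric_rightMul _⟩, isInvariant_vol,
    ⟨vol_univ_pos hA hn.le, vol_univ_lt_top hA, isProbabilityMeasure_uniform hA hn.le,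
      isInvariant_uniform, fun μ _ hμ => ?_⟩, fun K Ω _ P _ F hF => ?_⟩
  · have := isProbabilityMeasure_uniform hA hn.le
    exact eq_of_isInvariant hA hμ isInvariant_uniform
  · have hK := (continuous_leftMul (A := A) (n := n) K).measurable
    refine ⟨hK.comp_aemeasurable hF.aemeasurable, ?_⟩
    rw [← map_leftMul_uniform hA hn.le K, ← hF.map_eq,
      AEMeasurable.map_map_of_aemeasurable hK.aemeasurable hF.aemeasurable]
    rfl
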